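/- **Setting.** Let $P$ be a probability distribution of $(X,Y)$ on $\mathcal X\times\{0,1\}$ with $\pi_+=P(Y=1)>0$, let $P_+=P(X\mid Y=1)$, let $P_X$ be the marginal of $X$, and let $f^\star(x)=\mathbb E[Y\mid X=x]$. A predictor is a measurable map $f:\mathcal X\to[0,1]$. Let $\mathcal C$ be a class of measurable $c:\mathcal X\to\mathbb R$ with $|c|\le 1$, and $\mathcal W$ a finite class of measurable $w:[0,1]\to\mathbb R$ with $\|w\|_\infty\le1$. A predictor $f$ is $(\mathcal C,\mathcal W,\varepsilon)$-multicalibrated if $$\sup_{c\in\mathcal C,\,w\in\mathcal W}\bigl|\mathbb E[c(X)w(f(X))(Y-f(X))]\bigr|\le\varepsilon .$$ For a batch $S=(S^+,S^u)$ with $S^+=(X_i^+)_{i\le n_+}$ and $S^u=(X_j^u)_{j\le n_u}$ put $$\widehat R_{c,w}(f;S)=\frac{\pi_+}{n_+}\sum_{i=1}^{n_+}c(X_i^+)w(f(X_i^+))-\frac1{n_u}\sum_{j=1}^{n_u}c(X_j^u)w(f(X_j^u))f(X_j^u).$$ The Rademacher complexity is $\mathfrak R_n(\mathcal C;Q)=\mathbb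 E_{X_1,\dots,X_n\sim Q,\ \sigma}\bigl[\sup_{c\in\mathcal C}\frac1n\sum_{i=1}^n\sigma_ic(X_i)\bigr]$, where the $X_i$ are i.i.d. and the $\sigma_i\in\{\pm1\}$ are independent uniform signs; for every sign vector the supremum is assumed to be measurable as a function of $(X_1,\dots,X_n)$, for $(n,Q)=(n_+,P_+)$ and $(n_u,P_X)$. **Algorithm (WLMC).** Given $\varepsilon>0$ and a predictor $f_0$, at step $t=0,1,2,\dots$ draw a fresh independent batch $S_t\sim P_+^{n_+}\otimes P_X^{n_u}$. If some $(\tau,c,w)\in\{\pm1\}\times\mathcal C\times\mathcal W$ satisfies $\tau\widehat R_{c,w}(f_t;S_t)>3\varepsilon/4$, choose such a triple $(\tau_t,c_t,w_t)$ by an arbitrary measurable rule depending on $S_0,\dots,S_t$, and set $$f_{t+1}(x)=\Pi_{[0,1]}\bigl[f_t(x)+\tfrac{\varepsilon}{2}\tau_tc_t(x)w_t(f_t(x))\bigr],$$ where $\Pi_{[0,1]}$ is the projection onto $[0,1]$; otherwise stop and output $f_t$. **Theorem (Formal PU guarantee under Rademacher complexity).** For every $C_R\ge0$ there is a constant $A>0$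 depending only on $C_R$ such that the following holds in every setting as above. Let $\varepsilon,\delta>0$, $d_{\mathcal C}\ge0$, and suppose that $$\mathfrak R_{n_+}(\mathcal C;P_+)\le C_R\sqrt{\frac{d_{\mathcal C}\log n_+}{n_+}},\qquad \mathfrak R_{n_u}(\mathcal C;P_X)\le C_R\sqrt{\frac{d_{\mathcal C}\log n_u}{n_u}} .$$ Let $D_0=\mathbb E[(f_0(X)-f^\star(X))^2]$, $K_\varepsilon=\lceil4D_0/\varepsilon^2\rceil$ and $L=\log\frac{4|\mathcal W|(K_\varepsilon+1)}{\delta}$. If $$n_+\ge\frac{A\pi_+^2}{\varepsilon^2}\,(d_{\mathcal C}\log n_++L),\qquad n_u\ge\frac{A}{\varepsilon^2}\,(d_{\mathcal C}\log n_u+L),$$ then, with probability at least $1-\delta$, WLMC stops after some number $T\le K_\varepsilon$ of updates, where moreover $T\le4D_0/\varepsilon^2$, its output $f_T$ is a $(\mathcal C,\mathcal W,\varepsilon)$-multicalibrated predictor, and the total numbers of samples it draws from the two sources satisfy $N_+\le(K_\varepsilon+1)n_+$ and $N_u\le(K_\varepsilon+1)n_u$. In particular, if $n_+=n_u=n$ and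 $|\mathcal W|(K_\varepsilon+1)\ge2\delta$ (for instance, if $\mathcal W\ne\emptyset$ and $\delta\le1/2$), the same conclusion holds as soon as $$n\ge\frac{A}{\varepsilon^2}\Bigl[d_{\mathcal C}\log n+\log|\mathcal W|+\log\frac{K_\varepsilon+1}{\delta}\Bigr].$$ -/

import Mathlib

open MeasureTheory ProbabilityTheory

noncomputable section

namespace WLMC

/-- The numerical value in `{0, 1}` of a binary label. -/
def label (y : Bool) : ℝ := if y then 1 else 0

section Population

variable {𝓧 : Type*} [MeasurableSpace 𝓧]

/-- The class prior `π₊ = P(Y = 1)`. -/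
def prior (P : Measure (𝓧 × Bool)) : ℝ := P.real (Prod.snd ⁻¹' {true})

/-- The class-conditional distribution `P₊ = P(X ∣ Y = 1)`. -/
def posDist (P : Measure (𝓧 × Bool)) : Measure 𝓧 :=
  (ProbabilityTheory.cond P (Prod.snd ⁻¹' {true})).map Prod.fst

/-- The marginal distribution `P_X` of the inputs. -/
def inputDist (P : Measure (𝓧 × Bool)) : Measure 𝓧 := P.map Prod.fst

/-- The regression function `f⋆(x) = 𝔼[Y ∣ X = x]`, through the regular conditional
distribution of `Y` given `X`. -/
def regression (P : Measure (𝓧 × Bool)) [IsFiniteMeasure P] (x : 𝓧) : ℝ :=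
  ∫ y, label y ∂(P.condKernel x)

/-- `D₀ = 𝔼[(f₀(X) - f⋆(X))²]`. -/
def initialGap (P : Measure (𝓧 × Bool)) [IsFiniteMeasure P] (f₀ : 𝓧 → unitInterval) : ℝ :=
  ∫ p, ((f₀ p.1 : ℝ) - regression P p.1) ^ 2 ∂P

/-- `K_ε = ⌈4 D₀ / ε²⌉`. -/
def updateBound (P : Measure (𝓧 × Bool)) [IsFiniteMeasure P] (f₀ : 𝓧 → unitInterval)
    (ε : ℝ) : ℕ :=
  ⌈4 * initialGap P f₀ / ε ^ 2⌉₊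

/-- The witness moment `R_{c,w}(f) = 𝔼[c(X) w(f(X)) (Y - f(X))]`. -/
def moment (P : Measure (𝓧 × Bool)) (c : 𝓧 → ℝ) (w : unitInterval → ℝ)
    (f : 𝓧 → unitInterval) : ℝ :=
  ∫ p, c p.1 * w (f p.1) * (label p.2 - (f p.1 : ℝ)) ∂P

/-- The multicalibration error `sup_{c, w} |R_{c,w}(f)|`. -/
def mcError (P : Measure (𝓧 × Bool)) (𝒞 : Set (𝓧 → ℝ)) (𝒲 : Finset (unitInterval → ℝ))
    (f : 𝓧 → unitInterval) : ℝ :=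
  sSup {r : ℝ | ∃ c ∈ 𝒞, ∃ w ∈ 𝒲, r = |moment P c w f|}

/-- `f` is `(𝒞, 𝒲, ε)`-multicalibrated. -/
def IsMulticalibrated (P : Measure (𝓧 × Bool)) (𝒞 : Set (𝓧 → ℝ))
    (𝒲 : Finset (unitInterval → ℝ)) (ε : ℝ) (f : 𝓧 → unitInterval) : Prop :=
  mcError P 𝒞 𝒲 f ≤ ε

/-- `sup_{c ∈ 𝒞} (1/n) ∑ᵢ σᵢ c(xᵢ)` for a sign vector `σ` and sample points `x`. -/
def signedSup (𝒞 : Set (𝓧 → ℝ)) {n : ℕ} (σ : Fin n → ℤˣ) (x : Fin n → 𝓧) : ℝ :=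
  ⨆ c : 𝒞, (1 / (n : ℝ)) * ∑ i, ((σ i : ℤ) : ℝ) * c.1 (x i)

/-- The expected Rademacher complexity `𝔼_{S ∼ Qⁿ, σ} sup_{c ∈ 𝒞} (1/n) ∑ᵢ σᵢ c(Xᵢ)`; the
expectation over the `2ⁿ` equally likely sign vectors is written as a finite average. -/
def rademacher (𝒞 : Set (𝓧 → ℝ)) (n : ℕ) (Q : Measure 𝓧) : ℝ :=
  (1 / 2 ^ n : ℝ) * ∑ σ : Fin n → ℤˣ, ∫ x, signedSup 𝒞 σ x ∂(Measure.pi fun _ : Fin n => Q)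

/-- The random variable inside the Rademacher complexity is measurable, so that its expectation
makes sense. -/
def RademacherMeasurable (𝒞 : Set (𝓧 → ℝ)) (n : ℕ) (Q : Measure 𝓧) : Prop :=
  ∀ σ : Fin n → ℤˣ, AEMeasurable (signedSup 𝒞 σ) (Measure.pi fun _ : Fin n => Q)

end Population

section Algorithm

/-- A weak batch: `n₊` positive inputs and `nᵤ` unlabeled inputs. -/
abbrev Batch (𝓧 : Type*) (np nu : ℕ) : Type _ := (Fin np → 𝓧) × (Fin nu → 𝓧)

/-- The law `P₊^{n₊} ⊗ P_X^{nᵤ}` of a batch. -/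
def batchLaw {𝓧 : Type*} [MeasurableSpace 𝓧] (P : Measure (𝓧 × Bool)) (np nu : ℕ) :
    Measure (Batch 𝓧 np nu) :=
  (Measure.pi fun _ : Fin np => posDist P).prod (Measure.pi fun _ : Fin nu => inputDist P)

/-- The empirical PU moment with positive class prior `π`. -/
def empMoment {𝓧 : Type*} {np nu : ℕ} (π : ℝ) (c : 𝓧 → ℝ) (w : unitInterval → ℝ)
    (f : 𝓧 → unitInterval) (S : Batch 𝓧 np nu) : ℝ :=
  π / np * ∑ i, c (S.1 i) * w (f (S.1 i))
    - 1 / (nu : ℝ) * ∑ j, c (S.2 j) * w (f (S.2 j)) * (f (S.2 j) : ℝ)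

/-- A candidate direction `(τ, c, w)` with `τ ∈ {±1}`. -/
structure Witness (𝓧 : Type*) where
  sign : ℤˣ
  group : 𝓧 → ℝ
  test : unitInterval → ℝ

/-- The value `τ c(x) w(v)` of a witness at an input `x` and a score `v`. -/
def Witness.direction {𝓧 : Type*} (q : Witness 𝓧) (x : 𝓧) (v : unitInterval) : ℝ :=
  ((q.sign : ℤ) : ℝ) * q.group x * q.test v

/-- `(τ, c, w) ∈ {±1} × 𝒞 × 𝒲` and `τ R̂_{c,w}(f; S) > 3ε/4`. -/
def IsViolating {𝓧 : Type*} {np nu : ℕ} (π ε : ℝ) (𝒞 : Set (𝓧 → ℝ))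
    (𝒲 : Finset (unitInterval → ℝ)) (f : 𝓧 → unitInterval) (S : Batch 𝓧 np nu)
    (q : Witness 𝓧) : Prop :=
  q.group ∈ 𝒞 ∧ q.test ∈ 𝒲 ∧
    3 * ε / 4 < ((q.sign : ℤ) : ℝ) * empMoment π q.group q.test f S

/-- One update `x ↦ Π_{[0,1]}[f(x) + lam τ c(x) w(f(x))]`. -/
def update {𝓧 : Type*} (lam : ℝ) (q : Witness 𝓧) (f : 𝓧 → unitInterval) : 𝓧 → unitInterval :=
  fun x => Set.projIcc (0 : ℝ) 1 zero_le_one ((f x : ℝ) + lam * q.direction x (f x))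

/-- A rule by which the algorithm picks its witness in step `t` from the batches
`S₀, …, S_t` drawn so far. -/
abbrev Rule (𝓧 : Type*) (np nu : ℕ) : Type _ :=
  (t : ℕ) → (Fin (t + 1) → Batch 𝓧 np nu) → Witness 𝓧

/-- The iterate `f_t` with step size `ε/2` on the batches `S₀, S₁, …`. It is the predictor held
by the algorithm as long as the algorithm has not stopped before step `t`; later values are
never used. -/
def iterate {𝓧 : Type*} {np nu : ℕ} (ε : ℝ) (f₀ : 𝓧 → unitInterval) (rule : Rule 𝓧 np nu)
    (S : ℕ → Batch 𝓧 np nu) : ℕ → 𝓧 → unitInterval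
  | 0 => f₀
  | t + 1 => update (ε / 2) (rule t fun i => S i) (iterate ε f₀ rule S t)

/-- The while-condition in step `t`: some witness is violating for `f_t` on the batch `S_t`. -/
def Continues {𝓧 : Type*} {np nu : ℕ} (π ε : ℝ) (𝒞 : Set (𝓧 → ℝ))
    (𝒲 : Finset (unitInterval → ℝ)) (f₀ : 𝓧 → unitInterval) (rule : Rule 𝓧 np nu)
    (S : ℕ → Batch 𝓧 np nu) (t : ℕ) : Prop :=
  ∃ q : Witness 𝓧, IsViolating π ε 𝒞 𝒲 (iterate ε f₀ rule S t) (S t) q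

/-- The algorithm stops after exactly `T` updates. -/
def StopsAfter {𝓧 : Type*} {np nu : ℕ} (π ε : ℝ) (𝒞 : Set (𝓧 → ℝ))
    (𝒲 : Finset (unitInterval → ℝ)) (f₀ : 𝓧 → unitInterval) (rule : Rule 𝓧 np nu)
    (S : ℕ → Batch 𝓧 np nu) (T : ℕ) : Prop :=
  (∀ t < T, Continues π ε 𝒞 𝒲 f₀ rule S t) ∧ ¬ Continues π ε 𝒞 𝒲 f₀ rule S T

/-- In every step that the algorithm reaches with the while-condition true, the rule returns a
violating witness. -/
def Rule.IsValid {𝓧 : Type*} {np nu : ℕ} (rule : Rule 𝓧 np nu) (π ε : ℝ) (𝒞 : Set (𝓧 → ℝ))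
    (𝒲 : Finset (unitInterval → ℝ)) (f₀ : 𝓧 → unitInterval) : Prop :=
  ∀ (S : ℕ → Batch 𝓧 np nu) (t : ℕ), (∀ s ≤ t, Continues π ε 𝒞 𝒲 f₀ rule S s) →
    IsViolating π ε 𝒞 𝒲 (iterate ε f₀ rule S t) (S t) (rule t fun i => S i)

/-- The chosen direction is jointly measurable in the data, the input and the score. -/
def Rule.IsMeasurable {𝓧 : Type*} [MeasurableSpace 𝓧] {np nu : ℕ} (rule : Rule 𝓧 np nu) :
    Prop :=
  ∀ t : ℕ, Measurable fun p : (Fin (t + 1) → Batch 𝓧 np nu) × 𝓧 × unitInterval =>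
    (rule t p.1).direction p.2.1 p.2.2

/-- The number of samples that a run with `T` updates draws from a source with batch size `n`:
the batches `S₀, …, S_T` are drawn. -/
def totalDraws (n T : ℕ) : ℕ := ∑ _t ∈ Finset.range (T + 1), n

end Algorithm

end WLMC

end

universe u v

/-! The proof combines a potential argument with a uniform deviation bound. Suppose that in every
step `t ≤ K_ε` all empirical moments of the current iterate are within `ε/4` of the true ones
(`Accurate`). A violating witness then has true signed moment above `3ε/4 - ε/4 = ε/2`. This moment
is an inner product of the direction with `f⋆ - f_t`, so the projected step of length `ε/2` lowers
`𝔼(f_t - f⋆)²` by at least `ε²/4` (`initialGap_update_add_le`). Hence there are at most `4 D₀ / ε²`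
updates. On stopping, every moment is at most `3ε/4 + ε/4 = ε` in absolute value.

Accuracy has to be uniform over `𝒞`, although `f_t` is random. The batch `S_t` is independent of the
past, so `w(f_t(x))`, respectively `w(f_t(x)) f_t(x)`, is a multiplier `h(U, x) ∈ [-1, 1]` with `U`
independent of the sample. `measure_exists_deviation_ge_le` bounds the deviations of `h(U, ·) c`
over `c ∈ 𝒞` by the Rademacher complexity of `𝒞` alone. After symmetrization by a ghost sample, the
multipliers are rounded to independent random signs with these means. By Jensen's inequality
rounding can only increase the exponential moment, and the rounded signs are absorbed into the
uniform Rademacher signs. What remains is the exponential moment of `signedSup`, controlled by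
bounded differences in the signs and in the sample.

Only `signedSup` is assumed to be measurable, not the supremum of the deviations. Hence each single
`c` is bounded pointwise by one majorant independent of `c`, and Markov's inequality is applied to
that majorant. A union bound over two sides, two sources, `𝒲` and `K_ε + 1` steps costs the factor
inside the logarithm `L`. -/

noncomputable section

namespace WLMC

/-! ### Exponential moments under bounded differences. -/

section BoundedDifferences

variable {E : Type*} [MeasurableSpace E]

theorem integrable_of_abs_le {α : Type*} [MeasurableSpace α] {μ : Measure α} [IsFiniteMeasure μ]
    {g : α → ℝ} {B : ℝ} (hg : AEMeasurable g μ) (hB : ∀ x, |g x| ≤ B) : Integrable g μ :=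
  Integrable.of_bound hg.aestronglyMeasurable B (Filter.Eventually.of_forall hB)

theorem integrable_exp_mul_of_abs_le {α : Type*} [MeasurableSpace α] {μ : Measure α}
    [IsFiniteMeasure μ] {g : α → ℝ} {B : ℝ} (hg : AEMeasurable g μ) (hB : ∀ x, |g x| ≤ B)
    (l : ℝ) : Integrable (fun x => Real.exp (l * g x)) μ := by
  refine integrable_of_abs_le (B := Real.exp (|l| * B))
    (Real.measurable_exp.comp_aemeasurable (hg.const_mul l)) fun x => ?_
  rw [abs_of_pos (Real.exp_pos _), Real.exp_le_exp]
  refine (le_abs_self _).trans ?_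
  rw [abs_mul]
  exact mul_le_mul_of_nonneg_left (hB x) (abs_nonneg l)

/-- Hoeffding's lemma for a function whose oscillation on a set of full measure is at most `b`. -/
theorem integral_exp_le_of_oscillation {Q : Measure E} [IsProbabilityMeasure Q] {G : E → ℝ}
    {B b : ℝ} (hG : AEMeasurable G Q) (hB : ∀ x, |G x| ≤ B) {s : Set E}
    (hs : ∀ᵐ x ∂Q, x ∈ s) (hb : ∀ x ∈ s, ∀ y ∈ s, G x - G y ≤ b) (l : ℝ) :
    ∫ x, Real.exp (l * G x) ∂Q ≤ Real.exp (l * ∫ x, G x ∂Q + b ^ 2 * l ^ 2 / 8) := by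
  have hbdd : BddBelow (G '' s) := ⟨-B, by rintro _ ⟨x, -, rfl⟩; exact (abs_le.1 (hB x)).1⟩
  set a := sInf (G '' s)
  have hmem : ∀ᵐ x ∂Q, G x ∈ Set.Icc a (a + b) := by
    filter_upwards [hs] with x hx
    refine ⟨csInf_le hbdd ⟨x, hx, rfl⟩, ?_⟩
    have : G x - b ≤ a := le_csInf ⟨_, x, hx, rfl⟩ (by
      rintro _ ⟨y, hy, rfl⟩
      linarith [hb x hx y hy])
    linarith
  have h := (hasSubgaussianMGF_of_mem_Icc hG hmem).mgf_le l
  have h1 : ∫ x, Real.exp (l * G x) ∂Q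
      = Real.exp (l * ∫ x, G x ∂Q) * mgf (fun x => G x - ∫ y, G y ∂Q) Q l := by
    rw [mgf, ← integral_const_mul]
    congr 1
    ext x
    rw [← Real.exp_add]
    ring_nf
  rw [h1, Real.exp_add]
  refine mul_le_mul_of_nonneg_left (h.trans ?_) (Real.exp_pos _).le
  rw [Real.exp_le_exp]
  simp only [NNReal.coe_pow, NNReal.coe_div, coe_nnnorm, Real.norm_eq_abs, NNReal.coe_ofNat,
    div_pow, add_sub_cancel_left, sq_abs]
  apply le_of_eq
  ring

/-- The exponential moment bound behind McDiarmid's inequality. -/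
theorem integral_exp_le_of_boundedDifferences (Q : Measure E) [IsProbabilityMeasure Q] {B b : ℝ}
    (l : ℝ) (n : ℕ) (g : (Fin n → E) → ℝ) (hg : AEMeasurable g (Measure.pi fun _ => Q))
    (hB : ∀ x, |g x| ≤ B) (hb : ∀ x i e, |g (Function.update x i e) - g x| ≤ b) :
    ∫ x, Real.exp (l * g x) ∂(Measure.pi fun _ : Fin n => Q) ≤
      Real.exp (l * ∫ x, g x ∂(Measure.pi fun _ : Fin n => Q) + n * b ^ 2 * l ^ 2 / 8) := by
  induction n with
  | zero =>
    have h : ∀ x, g x = g (fun i => i.elim0) := fun x => congrArg g (Subsingleton.elim _ _)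
    simp [h]
  | succ n ih =>
    set ν := Measure.pi fun _ : Fin n => Q
    have hmp := (measurePreserving_piFinSuccAbove (fun _ : Fin (n + 1) => Q) 0).symm
    set φ : E × (Fin n → E) → ℝ := fun p => g (Fin.cons p.1 p.2)
    have hφe : ∀ p, g ((MeasurableEquiv.piFinSuccAbove (fun _ : Fin (n + 1) => E) 0).symm p) = φ p :=
      fun p => by
        simp only [φ, MeasurableEquiv.piFinSuccAbove_symm_apply, Fin.insertNthEquiv,
          Equiv.coe_fn_mk, Fin.insertNth_zero]
        rfl
    have hφm : AEMeasurable φ (Q.prod ν) := by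
      have := hg.comp_quasiMeasurePreserving hmp.quasiMeasurePreserving
      exact this.congr (Filter.Eventually.of_forall hφe)
    have hφB : ∀ p, |φ p| ≤ B := fun p => hB _
    have hint (F : ℝ → ℝ) : ∫ x, F (g x) ∂(Measure.pi fun _ : Fin (n + 1) => Q)
        = ∫ p, F (φ p) ∂(Q.prod ν) := by
      rw [← hmp.integral_comp' (fun x => F (g x))]
      exact integral_congr_ae (Filter.Eventually.of_forall fun p => by simp only [hφe])
    have h1 := hint id
    have h2 := hint (fun r => Real.exp (l * r))
    simp only [id] at h1
    rw [h1, h2, integral_prod _ (integrable_of_abs_le hφm hφB),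
      integral_prod _ (integrable_exp_mul_of_abs_le hφm hφB l)]
    -- The conditional mean given the first coordinate; its oscillation costs one term `b² l² / 8`,
    -- and the induction hypothesis handles the remaining coordinates.
    set G : E → ℝ := fun e => ∫ y, φ (e, y) ∂ν
    have hGm : AEMeasurable G Q :=
      (AEStronglyMeasurable.integral_prod_right' hφm.aestronglyMeasurable).aemeasurable
    have hGB : ∀ e, |G e| ≤ B := fun e => by
      simpa using norm_integral_le_of_norm_le_const (μ := ν) (f := fun y => φ (e, y))
        (Filter.Eventually.of_forall fun y => hφB (e, y))
    -- As `g` is only a.e. measurable, sections are measurable for almost every `e` only; off `s`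
    -- the default value `0` of the integral could spoil the oscillation bound.
    set s : Set E := {e | AEMeasurable (fun y => φ (e, y)) ν}
    have hs : ∀ᵐ e ∂Q, e ∈ s := by
      filter_upwards [hφm.aestronglyMeasurable.prodMk_left] with e he
      exact he.aemeasurable
    have hosc : ∀ x ∈ s, ∀ y ∈ s, G x - G y ≤ b := by
      intro x hx y hy
      rw [← integral_sub (integrable_of_abs_le hx fun _ => hφB _)
        (integrable_of_abs_le hy fun _ => hφB _)]
      refine (le_abs_self _).trans ?_
      have := norm_integral_le_of_norm_le_const (μ := ν) (f := fun z => φ (x, z) - φ (y, z))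
        (C := b) (Filter.Eventually.of_forall fun z => by
          have := hb (Fin.cons y z) 0 x
          rwa [Fin.update_cons_zero] at this)
      simpa using this
    have hsec : ∀ᵐ e ∂Q, ∫ y, Real.exp (l * φ (e, y)) ∂ν
        ≤ Real.exp (l * G e) * Real.exp (n * b ^ 2 * l ^ 2 / 8) := by
      filter_upwards [hs] with e he
      rw [← Real.exp_add]
      refine ih (fun y => φ (e, y)) he (fun y => hφB _) fun y i e' => ?_
      have := hb (Fin.cons e y) i.succ e'
      rwa [← Fin.cons_update] at this
    calc ∫ e, ∫ y, Real.exp (l * φ (e, y)) ∂ν ∂Q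
        ≤ ∫ e, Real.exp (l * G e) * Real.exp (n * b ^ 2 * l ^ 2 / 8) ∂Q :=
          integral_mono_ae (integrable_exp_mul_of_abs_le hφm hφB l).integral_prod_left
            ((integrable_exp_mul_of_abs_le hGm hGB l).mul_const _) hsec
      _ = (∫ e, Real.exp (l * G e) ∂Q) * Real.exp (n * b ^ 2 * l ^ 2 / 8) :=
          integral_mul_const _ _
      _ ≤ Real.exp (l * ∫ e, G e ∂Q + b ^ 2 * l ^ 2 / 8)
            * Real.exp (n * b ^ 2 * l ^ 2 / 8) :=
          mul_le_mul_of_nonneg_right (integral_exp_le_of_oscillation hGm hGB hs hosc l)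
            (Real.exp_pos _).le
      _ = _ := by
          rw [← Real.exp_add]
          push_cast
          ring_nf

end BoundedDifferences

/-! ### Concentration of the signed supremum. -/

section Rademacher

/-- Turns the finite average over signs into a product integral, so that the bounded differences
inequality also applies to the signs. -/
theorem integral_pi_uniform_sign [MeasurableSpace ℤˣ] [MeasurableSingletonClass ℤˣ] (n : ℕ)
    (G : (Fin n → ℤˣ) → ℝ) :
    ∫ σ, G σ ∂(Measure.pi fun _ : Fin n => uniformOn (Set.univ : Set ℤˣ))
      = (1 / 2 ^ n : ℝ) * ∑ σ, G σ := by
  have : IsProbabilityMeasure (uniformOn (Set.univ : Set ℤˣ)) :=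
    isProbabilityMeasure_uniformOn Set.finite_univ Set.univ_nonempty
  rw [integral_fintype (Integrable.of_finite), Finset.mul_sum]
  refine Finset.sum_congr rfl fun σ _ => ?_
  have h : ∀ s : ℤˣ, uniformOn (Set.univ : Set ℤˣ) {s} = 2⁻¹ := fun s => by
    rw [uniformOn_univ]
    simp
  simp [Measure.real, Measure.pi_singleton, h]

/-- The bounded differences bound for the average over uniform sign vectors. -/
theorem average_exp_le_of_boundedDifferences {B b : ℝ} (l : ℝ) (n : ℕ) (G : (Fin n → ℤˣ) → ℝ)
    (hB : ∀ σ, |G σ| ≤ B) (hb : ∀ σ i s, |G (Function.update σ i s) - G σ| ≤ b) :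
    (1 / 2 ^ n : ℝ) * ∑ σ, Real.exp (l * G σ) ≤
      Real.exp (l * ((1 / 2 ^ n : ℝ) * ∑ σ, G σ) + n * b ^ 2 * l ^ 2 / 8) := by
  let _ : MeasurableSpace ℤˣ := ⊤
  have : IsProbabilityMeasure (uniformOn (Set.univ : Set ℤˣ)) :=
    isProbabilityMeasure_uniformOn Set.finite_univ Set.univ_nonempty
  have h := integral_exp_le_of_boundedDifferences (uniformOn (Set.univ : Set ℤˣ)) l n G
    (measurable_of_finite G).aemeasurable hB hb
  rwa [integral_pi_uniform_sign n fun σ => Real.exp (l * G σ), integral_pi_uniform_sign n G] at h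

theorem abs_iSup_sub_iSup_le {ι : Type*} {u v : ι → ℝ} {b : ℝ} (hb : 0 ≤ b)
    (hu : BddAbove (Set.range u)) (hv : BddAbove (Set.range v)) (huv : ∀ c, |u c - v c| ≤ b) :
    |(⨆ c, u c) - ⨆ c, v c| ≤ b := by
  cases isEmpty_or_nonempty ι with
  -- Over an empty index both real suprema take the default value `0`.
  | inl h => simpa using hb
  | inr h =>
    rw [abs_sub_le_iff, sub_le_iff_le_add, sub_le_iff_le_add]
    constructor
    · refine ciSup_le fun c => ?_
      linarith [le_ciSup hv c, (abs_sub_le_iff.1 (huv c)).1]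
    · refine ciSup_le fun c => ?_
      linarith [le_ciSup hu c, (abs_sub_le_iff.1 (huv c)).2]

theorem abs_mean_le_one {n : ℕ} {a : Fin n → ℝ} (ha : ∀ i, |a i| ≤ 1) :
    |(1 / (n : ℝ)) * ∑ i, a i| ≤ 1 := by
  rcases Nat.eq_zero_or_pos n with rfl | hn
  · simp
  have hn' : (0 : ℝ) < n := by exact_mod_cast hn
  rw [abs_mul, abs_of_pos (by positivity), one_div, inv_mul_le_iff₀ hn', mul_one]
  calc |∑ i, a i| ≤ ∑ i, |a i| := Finset.abs_sum_le_sum_abs _ _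
    _ ≤ ∑ _i : Fin n, (1 : ℝ) := Finset.sum_le_sum fun i _ => ha i
    _ = n := by simp

theorem abs_mean_sub_mean_le {n : ℕ} {a a' : Fin n → ℝ} (ha : ∀ i, |a i| ≤ 1)
    (ha' : ∀ i, |a' i| ≤ 1) (i : Fin n) (h : ∀ j, j ≠ i → a' j = a j) :
    |(1 / (n : ℝ)) * ∑ j, a' j - (1 / (n : ℝ)) * ∑ j, a j| ≤ 2 / n := by
  rw [← mul_sub, ← Finset.sum_sub_distrib, Finset.sum_eq_single i
    (fun j _ hj => by rw [h j hj, sub_self]) (fun hi => absurd (Finset.mem_univ i) hi), abs_mul,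
    abs_of_nonneg (by positivity : (0 : ℝ) ≤ 1 / n), div_eq_mul_one_div 2 (n : ℝ), mul_comm]
  refine mul_le_mul_of_nonneg_right ?_ (by positivity)
  linarith [abs_sub (a' i) (a i), ha i, ha' i]

variable {𝓧 : Type*} {𝒞 : Set (𝓧 → ℝ)} {n : ℕ}

theorem abs_sign_mul_le {c : 𝓧 → ℝ} (hc : ∀ x, |c x| ≤ 1) (s : ℤˣ) (x : 𝓧) :
    |((s : ℤ) : ℝ) * c x| ≤ 1 := by
  rcases Int.units_eq_one_or s with rfl | rfl <;> simpa using hc x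

theorem bddAbove_signedMean (h𝒞 : ∀ c ∈ 𝒞, ∀ x, |c x| ≤ 1) (σ : Fin n → ℤˣ) (x : Fin n → 𝓧) :
    BddAbove (Set.range fun c : 𝒞 => (1 / (n : ℝ)) * ∑ i, ((σ i : ℤ) : ℝ) * c.1 (x i)) := by
  refine ⟨1, ?_⟩
  rintro _ ⟨c, rfl⟩
  exact (le_abs_self _).trans
    (abs_mean_le_one fun i => abs_sign_mul_le (h𝒞 c.1 c.2) (σ i) (x i))

theorem le_signedSup (h𝒞 : ∀ c ∈ 𝒞, ∀ x, |c x| ≤ 1) {c : 𝓧 → ℝ} (hc : c ∈ 𝒞)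
    (σ : Fin n → ℤˣ) (x : Fin n → 𝓧) :
    (1 / (n : ℝ)) * ∑ i, ((σ i : ℤ) : ℝ) * c (x i) ≤ signedSup 𝒞 σ x :=
  le_ciSup (bddAbove_signedMean h𝒞 σ x) ⟨c, hc⟩

theorem abs_signedSup_le (h𝒞 : ∀ c ∈ 𝒞, ∀ x, |c x| ≤ 1) (σ : Fin n → ℤˣ) (x : Fin n → 𝓧) :
    |signedSup 𝒞 σ x| ≤ 1 := by
  have := abs_iSup_sub_iSup_le (ι := 𝒞) (v := fun _ => 0) zero_le_one
    (bddAbove_signedMean h𝒞 σ x) ⟨0, by rintro _ ⟨c, rfl⟩; exact le_rfl⟩ fun c => by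
      rw [sub_zero]
      exact abs_mean_le_one fun i => abs_sign_mul_le (h𝒞 c.1 c.2) (σ i) (x i)
  simpa [signedSup] using this

theorem abs_signedSup_update_point_sub_le (h𝒞 : ∀ c ∈ 𝒞, ∀ x, |c x| ≤ 1) (σ : Fin n → ℤˣ)
    (x : Fin n → 𝓧) (i : Fin n) (e : 𝓧) :
    |signedSup 𝒞 σ (Function.update x i e) - signedSup 𝒞 σ x| ≤ 2 / n :=
  abs_iSup_sub_iSup_le (by positivity) (bddAbove_signedMean h𝒞 _ _)
    (bddAbove_signedMean h𝒞 _ _) fun c =>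
      abs_mean_sub_mean_le (fun _ => abs_sign_mul_le (h𝒞 c.1 c.2) _ _)
        (fun _ => abs_sign_mul_le (h𝒞 c.1 c.2) _ _) i fun j hj => by
          rw [Function.update_of_ne hj]

theorem abs_signedSup_update_sign_sub_le (h𝒞 : ∀ c ∈ 𝒞, ∀ x, |c x| ≤ 1) (σ : Fin n → ℤˣ)
    (x : Fin n → 𝓧) (i : Fin n) (s : ℤˣ) :
    |signedSup 𝒞 (Function.update σ i s) x - signedSup 𝒞 σ x| ≤ 2 / n :=
  abs_iSup_sub_iSup_le (by positivity) (bddAbove_signedMean h𝒞 _ _)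
    (bddAbove_signedMean h𝒞 _ _) fun c =>
      abs_mean_sub_mean_le (fun _ => abs_sign_mul_le (h𝒞 c.1 c.2) _ _)
        (fun _ => abs_sign_mul_le (h𝒞 c.1 c.2) _ _) i fun j hj => by
          rw [Function.update_of_ne hj]

/-- The signed supremum concentrates, jointly in the signs and the sample, around the Rademacher
complexity. -/
theorem average_integral_exp_signedSup_le [MeasurableSpace 𝓧] (Q : Measure 𝓧)
    [IsProbabilityMeasure Q] (h𝒞 : ∀ c ∈ 𝒞, ∀ x, |c x| ≤ 1) (hm : RademacherMeasurable 𝒞 n Q)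
    (hn : 0 < n) (l : ℝ) :
    (1 / 2 ^ n : ℝ) * ∑ σ : Fin n → ℤˣ,
        ∫ x, Real.exp (l * signedSup 𝒞 σ x) ∂(Measure.pi fun _ : Fin n => Q)
      ≤ Real.exp (l * rademacher 𝒞 n Q + l ^ 2 / n) := by
  have hn' : (n : ℝ) ≠ 0 := by exact_mod_cast hn.ne'
  set ν := Measure.pi fun _ : Fin n => Q
  set G : (Fin n → ℤˣ) → ℝ := fun σ => ∫ x, signedSup 𝒞 σ x ∂ν
  have hint : ∀ σ, Integrable (signedSup 𝒞 σ) ν := fun σ =>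
    integrable_of_abs_le (hm σ) (abs_signedSup_le h𝒞 σ)
  have hG : ∀ σ, |G σ| ≤ 1 := fun σ => by
    simpa using norm_integral_le_of_norm_le_const (μ := ν) (f := signedSup 𝒞 σ)
      (Filter.Eventually.of_forall fun x => abs_signedSup_le h𝒞 σ x)
  have hGb : ∀ σ i s, |G (Function.update σ i s) - G σ| ≤ 2 / n := fun σ i s => by
    simp only [G]
    rw [← integral_sub (hint _) (hint _)]
    simpa using norm_integral_le_of_norm_le_const (μ := ν)
      (f := fun x => signedSup 𝒞 (Function.update σ i s) x - signedSup 𝒞 σ x)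
      (Filter.Eventually.of_forall fun x => abs_signedSup_update_sign_sub_le h𝒞 σ x i s)
  -- Bounded differences are used twice, in the sample for fixed signs and then in the signs for the
  -- sample mean; each use contributes `l² / (2n)`.
  calc (1 / 2 ^ n : ℝ) * ∑ σ : Fin n → ℤˣ, ∫ x, Real.exp (l * signedSup 𝒞 σ x) ∂ν
      ≤ (1 / 2 ^ n : ℝ) * ∑ σ : Fin n → ℤˣ,
          Real.exp (l * G σ) * Real.exp (n * (2 / n) ^ 2 * l ^ 2 / 8) := by
        refine mul_le_mul_of_nonneg_left (Finset.sum_le_sum fun σ _ => ?_) (by positivity)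
        rw [← Real.exp_add]
        exact integral_exp_le_of_boundedDifferences Q l n _ (hm σ) (abs_signedSup_le h𝒞 σ)
          (abs_signedSup_update_point_sub_le h𝒞 σ)
    _ = ((1 / 2 ^ n : ℝ) * ∑ σ : Fin n → ℤˣ, Real.exp (l * G σ))
          * Real.exp (n * (2 / n) ^ 2 * l ^ 2 / 8) := by
        rw [← Finset.sum_mul]
        exact (mul_assoc _ _ _).symm
    _ ≤ Real.exp (l * rademacher 𝒞 n Q + n * (2 / n) ^ 2 * l ^ 2 / 8)
          * Real.exp (n * (2 / n) ^ 2 * l ^ 2 / 8) :=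
        mul_le_mul_of_nonneg_right (average_exp_le_of_boundedDifferences l n G hG hGb)
          (Real.exp_pos _).le
    _ = _ := by
        rw [← Real.exp_add]
        congr 1
        field_simp
        ring

end Rademacher

/-! ### Rounding bounded multipliers to random signs. -/

section Rounding

/-- The probability of the sign vector `s` under independent signs with means `a i`. -/
def signWeight {n : ℕ} (a : Fin n → ℝ) (s : Fin n → ℤˣ) : ℝ :=
  ∏ i, (1 + ((s i : ℤ) : ℝ) * a i) / 2

theorem sum_units_int (F : ℤˣ → ℝ) : ∑ s, F s = F 1 + F (-1) := by
  rw [show (Finset.univ : Finset ℤˣ) = {1, -1} from rfl, Finset.sum_pair (by decide)]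

/-- Independence of the coordinates, in the form of the distributive law. -/
theorem sum_prod_sign {n : ℕ} (F : Fin n → ℤˣ → ℝ) :
    ∑ s : Fin n → ℤˣ, ∏ i, F i (s i) = ∏ i, (F i 1 + F i (-1)) := by
  simp_rw [← sum_units_int, Finset.prod_univ_sum, Fintype.piFinset_univ]

theorem signWeight_nonneg {n : ℕ} {a : Fin n → ℝ} (ha : ∀ i, |a i| ≤ 1) (s : Fin n → ℤˣ) :
    0 ≤ signWeight a s := by
  refine Finset.prod_nonneg fun i _ => ?_
  have h := abs_le.1 (ha i)
  rcases Int.units_eq_one_or (s i) with hs | hs <;> simp only [hs] <;> push_cast <;> linarith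

theorem sum_signWeight {n : ℕ} (a : Fin n → ℝ) : ∑ s, signWeight a s = 1 := by
  simp only [signWeight]
  rw [sum_prod_sign fun i s => (1 + ((s : ℤ) : ℝ) * a i) / 2]
  refine Finset.prod_eq_one fun i _ => ?_
  push_cast
  ring

theorem sum_signWeight_mul {n : ℕ} (a : Fin n → ℝ) (j : Fin n) :
    ∑ s, signWeight a s * ((s j : ℤ) : ℝ) = a j := by
  have h : ∀ s : Fin n → ℤˣ, signWeight a s * ((s j : ℤ) : ℝ)
      = ∏ i, (1 + ((s i : ℤ) : ℝ) * a i) / 2 * (if i = j then ((s i : ℤ) : ℝ) else 1) := by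
    intro s
    rw [Finset.prod_mul_distrib, Finset.prod_ite_eq' Finset.univ j]
    simp [signWeight]
  simp_rw [h]
  rw [sum_prod_sign fun i s =>
    (1 + ((s : ℤ) : ℝ) * a i) / 2 * (if i = j then ((s : ℤ) : ℝ) else 1),
    Finset.prod_eq_single j]
  · simp only [if_true]
    push_cast
    ring
  · intro i _ hi
    simp only [hi, if_false]
    push_cast
    ring
  · exact fun hj => absurd (Finset.mem_univ j) hj

variable {𝓧 : Type*} {𝒞 : Set (𝓧 → ℝ)} {n : ℕ}

/-- The average of `exp (l · signedSup)` after the multipliers `a i ∈ [-1, 1]` are rounded to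
independent random signs with means `a i`. -/
def roundedExp (𝒞 : Set (𝓧 → ℝ)) (l : ℝ) (σ : Fin n → ℤˣ) (a : Fin n → ℝ) (x : Fin n → 𝓧) : ℝ :=
  ∑ s, signWeight a s * Real.exp (l * signedSup 𝒞 (σ * s) x)

/-- Since `a i` is the mean of the rounded sign `s i`, the exponent is an average over `s` of signed
means of `c`. Jensen's inequality moves the average outside `exp`, after which each signed mean is
at most `signedSup`. -/
theorem exp_weightedMean_le_roundedExp (h𝒞 : ∀ c ∈ 𝒞, ∀ x, |c x| ≤ 1) {c : 𝓧 → ℝ} (hc : c ∈ 𝒞)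
    {l : ℝ} (hl : 0 ≤ l) (σ : Fin n → ℤˣ) {a : Fin n → ℝ} (ha : ∀ i, |a i| ≤ 1)
    (x : Fin n → 𝓧) :
    Real.exp (l * ((1 / (n : ℝ)) * ∑ i, ((σ i : ℤ) : ℝ) * (a i * c (x i))))
      ≤ roundedExp 𝒞 l σ a x := by
  have h : l * ((1 / (n : ℝ)) * ∑ i, ((σ i : ℤ) : ℝ) * (a i * c (x i)))
      = ∑ s, signWeight a s •
          (l * ((1 / (n : ℝ)) * ∑ i, (((σ * s) i : ℤ) : ℝ) * c (x i))) := by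
    simp_rw [smul_eq_mul, Finset.mul_sum]
    rw [Finset.sum_comm]
    refine Finset.sum_congr rfl fun i _ => ?_
    rw [← sum_signWeight_mul a i, Finset.sum_mul, Finset.mul_sum, Finset.mul_sum, Finset.mul_sum]
    refine Finset.sum_congr rfl fun s _ => ?_
    simp only [Pi.mul_apply, Units.val_mul, Int.cast_mul]
    ring
  rw [h]
  refine (convexOn_exp.map_sum_le (fun s _ => signWeight_nonneg ha s) (sum_signWeight a)
    fun _ _ => Set.mem_univ _).trans ?_
  refine Finset.sum_le_sum fun s _ =>
    mul_le_mul_of_nonneg_left ?_ (signWeight_nonneg ha s)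
  exact Real.exp_le_exp.2 (mul_le_mul_of_nonneg_left (le_signedSup h𝒞 hc _ x) hl)

/-- For fixed `s` the map `σ ↦ σ * s` permutes the sign vectors, so the multipliers disappear. This
takes the place of a contraction inequality. -/
theorem sum_roundedExp (l : ℝ) (a : Fin n → ℝ) (x : Fin n → 𝓧) :
    ∑ σ, roundedExp 𝒞 l σ a x = ∑ σ, Real.exp (l * signedSup 𝒞 σ x) := by
  simp only [roundedExp]
  rw [Finset.sum_comm]
  calc ∑ s, ∑ σ : Fin n → ℤˣ, signWeight a s * Real.exp (l * signedSup 𝒞 (σ * s) x)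
      = ∑ s, signWeight a s * ∑ σ, Real.exp (l * signedSup 𝒞 σ x) := by
        refine Finset.sum_congr rfl fun s _ => ?_
        rw [← Finset.mul_sum]
        congr 1
        exact Equiv.sum_comp (Equiv.mulRight s) fun σ => Real.exp (l * signedSup 𝒞 σ x)
    _ = _ := by rw [← Finset.sum_mul, sum_signWeight, one_mul]

theorem roundedExp_nonneg (l : ℝ) (σ : Fin n → ℤˣ) {a : Fin n → ℝ} (ha : ∀ i, |a i| ≤ 1)
    (x : Fin n → 𝓧) : 0 ≤ roundedExp 𝒞 l σ a x :=
  Finset.sum_nonneg fun s _ => mul_nonneg (signWeight_nonneg ha s) (Real.exp_pos _).le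

theorem abs_roundedExp_le (h𝒞 : ∀ c ∈ 𝒞, ∀ x, |c x| ≤ 1) (l : ℝ) (σ : Fin n → ℤˣ)
    {a : Fin n → ℝ} (ha : ∀ i, |a i| ≤ 1) (x : Fin n → 𝓧) :
    |roundedExp 𝒞 l σ a x| ≤ Real.exp |l| := by
  rw [abs_of_nonneg (roundedExp_nonneg l σ ha x)]
  calc roundedExp 𝒞 l σ a x ≤ ∑ s, signWeight a s * Real.exp |l| := by
        refine Finset.sum_le_sum fun s _ =>
          mul_le_mul_of_nonneg_left (Real.exp_le_exp.2 ?_) (signWeight_nonneg ha s)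
        refine (le_abs_self _).trans ?_
        rw [abs_mul]
        exact mul_le_of_le_one_right (abs_nonneg l) (abs_signedSup_le h𝒞 _ x)
    _ = Real.exp |l| := by rw [← Finset.sum_mul, sum_signWeight, one_mul]

end Rounding

/-! ### Exchanging points with a ghost sample. -/

section Swap

variable {𝓧 : Type*} {n : ℕ}

/-- The sample that takes its `i`-th point from `x` if `σ i = 1` and from `x'` otherwise. -/
def mix (σ : Fin n → ℤˣ) (x x' : Fin n → 𝓧) : Fin n → 𝓧 := fun i => if σ i = 1 then x i else x' i

/-- Symmetrization as an identity valid for every `σ`: the right side consists of two signed means,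
each over a mixed sample that again has law `Qⁿ`. -/
theorem mean_sub_mean_eq_mix (σ : Fin n → ℤˣ) (g : 𝓧 → ℝ) (x x' : Fin n → 𝓧) :
    (1 / (n : ℝ)) * ∑ i, g (x i) - (1 / (n : ℝ)) * ∑ i, g (x' i)
      = (1 / (n : ℝ)) * ∑ i, ((σ i : ℤ) : ℝ) * g (mix σ x x' i)
        + (1 / (n : ℝ)) * ∑ i, (((-σ) i : ℤ) : ℝ) * g (mix σ x' x i) := by
  rw [← mul_sub, ← mul_add, ← Finset.sum_sub_distrib, ← Finset.sum_add_distrib]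
  congr 1
  refine Finset.sum_congr rfl fun i _ => ?_
  rcases Int.units_eq_one_or (σ i) with h | h
  · simp [mix, h, sub_eq_add_neg]
  · have h1 : ¬ ((-1 : ℤˣ) = 1) := by decide
    simp only [mix, h, h1, if_false, Pi.neg_apply, neg_neg]
    push_cast
    ring

theorem measurePreserving_mix [MeasurableSpace 𝓧] (Q : Measure 𝓧) [IsProbabilityMeasure Q]
    (σ : Fin n → ℤˣ) :
    MeasurePreserving (fun p : (Fin n → 𝓧) × (Fin n → 𝓧) => mix σ p.1 p.2)
      ((Measure.pi fun _ => Q).prod (Measure.pi fun _ => Q)) (Measure.pi fun _ => Q) := by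
  have hmeas : Measurable fun p : (Fin n → 𝓧) × (Fin n → 𝓧) => mix σ p.1 p.2 := by
    refine measurable_pi_lambda _ fun i => ?_
    by_cases h : σ i = 1
    · simp only [mix, h, if_true]
      fun_prop
    · simp only [mix, h, if_false]
      fun_prop
  refine ⟨hmeas, (Measure.pi_eq fun t ht => ?_).symm⟩
  have hpre : (fun p : (Fin n → 𝓧) × (Fin n → 𝓧) => mix σ p.1 p.2) ⁻¹' Set.univ.pi t
      = (Set.univ.pi fun i => if σ i = 1 then t i else Set.univ) ×ˢ
        (Set.univ.pi fun i => if σ i = 1 then Set.univ else t i) := by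
    ext p
    simp only [Set.mem_preimage, Set.mem_univ_pi, Set.mem_prod, ← forall_and]
    refine forall_congr' fun i => ?_
    by_cases h : σ i = 1 <;> simp [mix, h]
  rw [Measure.map_apply hmeas (MeasurableSet.univ_pi ht), hpre, Measure.prod_prod, Measure.pi_pi,
    Measure.pi_pi, ← Finset.prod_mul_distrib]
  refine Finset.prod_congr rfl fun i _ => ?_
  by_cases h : σ i = 1 <;> simp [h]

end Swap

/-! ### Uniform deviations with an independent random multiplier. -/

section Deviation

variable {𝓧 Z : Type*} {𝒞 : Set (𝓧 → ℝ)} {n : ℕ}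

/-- The symmetrized majorant, as a function of the parameter, the sample and the ghost sample. -/
def symmetrized (𝒞 : Set (𝓧 → ℝ)) (l : ℝ) (h : Z × 𝓧 → ℝ)
    (p : (Z × (Fin n → 𝓧)) × (Fin n → 𝓧)) : ℝ :=
  (1 / 2 ^ n : ℝ) * ∑ σ : Fin n → ℤˣ,
    (1 / 2 * roundedExp 𝒞 l σ (fun i => h (p.1.1, mix σ p.1.2 p.2 i)) (mix σ p.1.2 p.2)
      + 1 / 2 * roundedExp 𝒞 l (-σ) (fun i => h (p.1.1, mix σ p.2 p.1.2 i)) (mix σ p.2 p.1.2))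

/-- Midpoint convexity, `exp (l(A + B)) ≤ ½ exp (2lA) + ½ exp (2lB)`, separates the two mixed
samples and doubles `l`. The right side does not depend on `c`. -/
theorem exp_mean_sub_mean_le_symmetrized (h𝒞 : ∀ c ∈ 𝒞, ∀ x, |c x| ≤ 1) {c : 𝓧 → ℝ} (hc : c ∈ 𝒞)
    {h : Z × 𝓧 → ℝ} (hh : ∀ p, |h p| ≤ 1) {l : ℝ} (hl : 0 ≤ l)
    (p : (Z × (Fin n → 𝓧)) × (Fin n → 𝓧)) :
    Real.exp (l * ((1 / (n : ℝ)) * ∑ i, h (p.1.1, p.1.2 i) * c (p.1.2 i)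
        - (1 / (n : ℝ)) * ∑ i, h (p.1.1, p.2 i) * c (p.2 i)))
      ≤ symmetrized 𝒞 (2 * l) h p := by
  set E := Real.exp (l * ((1 / (n : ℝ)) * ∑ i, h (p.1.1, p.1.2 i) * c (p.1.2 i)
        - (1 / (n : ℝ)) * ∑ i, h (p.1.1, p.2 i) * c (p.2 i)))
  have hcard : ∑ _σ : Fin n → ℤˣ, E = 2 ^ n * E := by
    simp
  have hE : E = (1 / 2 ^ n : ℝ) * ∑ _σ : Fin n → ℤˣ, E := by
    rw [hcard]
    field_simp
  rw [hE, symmetrized]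
  refine mul_le_mul_of_nonneg_left (Finset.sum_le_sum fun σ _ => ?_) (by positivity)
  have h1 := exp_weightedMean_le_roundedExp h𝒞 hc (by positivity : 0 ≤ 2 * l) σ
    (fun i => hh (p.1.1, mix σ p.1.2 p.2 i)) (mix σ p.1.2 p.2)
  have h2 := exp_weightedMean_le_roundedExp h𝒞 hc (by positivity : 0 ≤ 2 * l) (-σ)
    (fun i => hh (p.1.1, mix σ p.2 p.1.2 i)) (mix σ p.2 p.1.2)
  have h3 := mean_sub_mean_eq_mix σ (fun y => h (p.1.1, y) * c y) p.1.2 p.2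
  simp only [E]
  rw [h3]
  refine le_trans ?_ (add_le_add (mul_le_mul_of_nonneg_left h1 (by norm_num))
    (mul_le_mul_of_nonneg_left h2 (by norm_num)))
  have hconv := convexOn_exp.2 (Set.mem_univ (2 * l * ((1 / (n : ℝ)) * ∑ i, ((σ i : ℤ) : ℝ) *
      (h (p.1.1, mix σ p.1.2 p.2 i) * c (mix σ p.1.2 p.2 i)))))
    (Set.mem_univ (2 * l * ((1 / (n : ℝ)) * ∑ i, (((-σ) i : ℤ) : ℝ) *
      (h (p.1.1, mix σ p.2 p.1.2 i) * c (mix σ p.2 p.1.2 i)))))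
    (by norm_num : (0 : ℝ) ≤ 1 / 2) (by norm_num : (0 : ℝ) ≤ 1 / 2) (by norm_num)
  simp only [smul_eq_mul] at hconv
  refine le_trans (le_of_eq ?_) hconv
  congr 1
  ring

theorem symmetrized_nonneg {h : Z × 𝓧 → ℝ} (hh : ∀ p, |h p| ≤ 1) (l : ℝ)
    (p : (Z × (Fin n → 𝓧)) × (Fin n → 𝓧)) : 0 ≤ symmetrized 𝒞 l h p := by
  refine mul_nonneg (by positivity) (Finset.sum_nonneg fun σ _ => add_nonneg ?_ ?_) <;>
  exact mul_nonneg (by norm_num) (roundedExp_nonneg _ _ (fun _ => hh _) _)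

variable [MeasurableSpace 𝓧] [MeasurableSpace Z] {Q : Measure 𝓧} {ρ : Measure Z}

theorem aemeasurable_roundedExp (hm : RademacherMeasurable 𝒞 n Q) {h : Z × 𝓧 → ℝ}
    (hhm : Measurable h) (l : ℝ) (σ : Fin n → ℤˣ) :
    AEMeasurable (fun q : Z × (Fin n → 𝓧) => roundedExp 𝒞 l σ (fun i => h (q.1, q.2 i)) q.2)
      (ρ.prod (Measure.pi fun _ => Q)) := by
  refine Finset.aemeasurable_fun_sum _ fun s _ => AEMeasurable.mul ?_ ?_
  · refine Measurable.aemeasurable ?_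
    simp only [signWeight]
    fun_prop
  · exact Real.measurable_exp.comp_aemeasurable (((hm (σ * s)).comp_snd).const_mul l)

variable [IsProbabilityMeasure Q] [IsProbabilityMeasure ρ]

theorem measurePreserving_param_mix (σ : Fin n → ℤˣ) :
    MeasurePreserving (fun p : (Z × (Fin n → 𝓧)) × (Fin n → 𝓧) => (p.1.1, mix σ p.1.2 p.2))
      ((ρ.prod (Measure.pi fun _ => Q)).prod (Measure.pi fun _ => Q))
      (ρ.prod (Measure.pi fun _ => Q)) :=
  ((MeasurePreserving.id ρ).prod (measurePreserving_mix Q σ)).comp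
    (measurePreserving_prodAssoc ρ (Measure.pi fun _ => Q) (Measure.pi fun _ => Q))

theorem measurePreserving_param_mix_swap (σ : Fin n → ℤˣ) :
    MeasurePreserving (fun p : (Z × (Fin n → 𝓧)) × (Fin n → 𝓧) => (p.1.1, mix σ p.2 p.1.2))
      ((ρ.prod (Measure.pi fun _ => Q)).prod (Measure.pi fun _ => Q))
      (ρ.prod (Measure.pi fun _ => Q)) :=
  ((MeasurePreserving.id ρ).prod ((measurePreserving_mix Q σ).comp
    Measure.measurePreserving_swap)).comp
      (measurePreserving_prodAssoc ρ (Measure.pi fun _ => Q) (Measure.pi fun _ => Q))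

theorem integrable_roundedExp (h𝒞 : ∀ c ∈ 𝒞, ∀ x, |c x| ≤ 1) (hm : RademacherMeasurable 𝒞 n Q)
    {h : Z × 𝓧 → ℝ} (hhm : Measurable h) (hh : ∀ p, |h p| ≤ 1) (l : ℝ) (σ : Fin n → ℤˣ) :
    Integrable (fun q : Z × (Fin n → 𝓧) => roundedExp 𝒞 l σ (fun i => h (q.1, q.2 i)) q.2)
      (ρ.prod (Measure.pi fun _ => Q)) :=
  integrable_of_abs_le (aemeasurable_roundedExp hm hhm l σ)
    fun _ => abs_roundedExp_le h𝒞 l σ (fun _ => hh _) _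

theorem integrable_symmetrized (h𝒞 : ∀ c ∈ 𝒞, ∀ x, |c x| ≤ 1) (hm : RademacherMeasurable 𝒞 n Q)
    {h : Z × 𝓧 → ℝ} (hhm : Measurable h) (hh : ∀ p, |h p| ≤ 1) (l : ℝ) :
    Integrable (symmetrized (n := n) 𝒞 l h)
      ((ρ.prod (Measure.pi fun _ => Q)).prod (Measure.pi fun _ => Q)) := by
  refine Integrable.const_mul (integrable_finsetSum _ fun σ _ => Integrable.add ?_ ?_) _
  · exact ((measurePreserving_param_mix σ).integrable_comp_of_integrable
      (integrable_roundedExp h𝒞 hm hhm hh l σ)).const_mul _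
  · exact ((measurePreserving_param_mix_swap σ).integrable_comp_of_integrable
      (integrable_roundedExp h𝒞 hm hhm hh l (-σ))).const_mul _

theorem integral_symmetrized_le (h𝒞 : ∀ c ∈ 𝒞, ∀ x, |c x| ≤ 1) (hm : RademacherMeasurable 𝒞 n Q)
    (hn : 0 < n) {h : Z × 𝓧 → ℝ} (hhm : Measurable h) (hh : ∀ p, |h p| ≤ 1) (l : ℝ) :
    ∫ p, symmetrized 𝒞 l h p ∂((ρ.prod (Measure.pi fun _ : Fin n => Q)).prod
        (Measure.pi fun _ => Q))
      ≤ Real.exp (l * rademacher 𝒞 n Q + l ^ 2 / n) := by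
  refine le_trans (le_of_eq ?_) (average_integral_exp_signedSup_le Q h𝒞 hm hn l)
  set ν := Measure.pi fun _ : Fin n => Q
  set w : (Fin n → ℤˣ) → Z × (Fin n → 𝓧) → ℝ :=
    fun σ q => roundedExp 𝒞 l σ (fun i => h (q.1, q.2 i)) q.2
  have hw : ∀ σ, Integrable (w σ) (ρ.prod ν) := integrable_roundedExp h𝒞 hm hhm hh l
  have hm1 := fun σ => measurePreserving_param_mix (Q := Q) (ρ := ρ) (n := n) σ
  have hm2 := fun σ => measurePreserving_param_mix_swap (Q := Q) (ρ := ρ) (n := n) σ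
  have hc1 : ∀ σ τ, Integrable (fun p : (Z × (Fin n → 𝓧)) × (Fin n → 𝓧) =>
      w τ (p.1.1, mix σ p.1.2 p.2)) ((ρ.prod ν).prod ν) := fun σ τ =>
    (hm1 σ).integrable_comp_of_integrable (hw τ)
  have hc2 : ∀ σ τ, Integrable (fun p : (Z × (Fin n → 𝓧)) × (Fin n → 𝓧) =>
      w τ (p.1.1, mix σ p.2 p.1.2)) ((ρ.prod ν).prod ν) := fun σ τ =>
    (hm2 σ).integrable_comp_of_integrable (hw τ)
  have hi1 : ∀ σ τ, ∫ p, w τ (p.1.1, mix σ p.1.2 p.2) ∂((ρ.prod ν).prod ν)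
      = ∫ q, w τ q ∂(ρ.prod ν) := fun σ τ => by
    have h := integral_map (f := w τ) (hm1 σ).measurable.aemeasurable
      (by rw [(hm1 σ).map_eq]; exact (hw τ).1)
    rw [(hm1 σ).map_eq] at h
    exact h.symm
  have hi2 : ∀ σ τ, ∫ p, w τ (p.1.1, mix σ p.2 p.1.2) ∂((ρ.prod ν).prod ν)
      = ∫ q, w τ q ∂(ρ.prod ν) := fun σ τ => by
    have h := integral_map (f := w τ) (hm2 σ).measurable.aemeasurable
      (by rw [(hm2 σ).map_eq]; exact (hw τ).1)
    rw [(hm2 σ).map_eq] at h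
    exact h.symm
  -- Negation permutes the sign vectors, so both halves of the majorant have the same total.
  have hsum : ∑ σ : Fin n → ℤˣ, ∫ q, w (-σ) q ∂(ρ.prod ν) = ∑ σ, ∫ q, w σ q ∂(ρ.prod ν) :=
    Equiv.sum_comp (Equiv.neg (Fin n → ℤˣ)) fun σ => ∫ q, w σ q ∂(ρ.prod ν)
  calc ∫ p, symmetrized 𝒞 l h p ∂((ρ.prod ν).prod ν)
      = (1 / 2 ^ n : ℝ) * ∑ σ : Fin n → ℤˣ, (1 / 2 * ∫ q, w σ q ∂(ρ.prod ν)
          + 1 / 2 * ∫ q, w (-σ) q ∂(ρ.prod ν)) := by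
        change ∫ p, (1 / 2 ^ n : ℝ) * ∑ σ : Fin n → ℤˣ, (1 / 2 * w σ (p.1.1, mix σ p.1.2 p.2)
          + 1 / 2 * w (-σ) (p.1.1, mix σ p.2 p.1.2)) ∂((ρ.prod ν).prod ν) = _
        have hadd : ∀ σ ∈ (Finset.univ : Finset (Fin n → ℤˣ)),
            Integrable (fun p : (Z × (Fin n → 𝓧)) × (Fin n → 𝓧) =>
              1 / 2 * w σ (p.1.1, mix σ p.1.2 p.2) + 1 / 2 * w (-σ) (p.1.1, mix σ p.2 p.1.2))
              ((ρ.prod ν).prod ν) := fun σ _ =>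
          ((hc1 σ σ).const_mul _).add ((hc2 σ (-σ)).const_mul _)
        rw [integral_const_mul, integral_finsetSum _ hadd]
        congr 1
        refine Finset.sum_congr rfl fun σ _ => ?_
        rw [integral_add ((hc1 σ σ).const_mul _) ((hc2 σ (-σ)).const_mul _), integral_const_mul,
          integral_const_mul, hi1, hi2]
    _ = (1 / 2 ^ n : ℝ) * ∑ σ : Fin n → ℤˣ, ∫ q, w σ q ∂(ρ.prod ν) := by
        rw [Finset.sum_add_distrib, ← Finset.mul_sum, ← Finset.mul_sum, hsum]
        ring
    _ = (1 / 2 ^ n : ℝ) * ∑ σ : Fin n → ℤˣ, ∫ x, Real.exp (l * signedSup 𝒞 σ x) ∂ν := by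
        have hexp : ∀ σ, Integrable (fun x => Real.exp (l * signedSup 𝒞 σ x)) ν := fun σ =>
          integrable_exp_mul_of_abs_le (hm σ) (abs_signedSup_le h𝒞 σ) l
        congr 1
        rw [← integral_finsetSum _ fun σ _ => hw σ, ← integral_finsetSum _ fun σ _ => hexp σ]
        simp only [w, sum_roundedExp]
        -- Summed over the signs, the integrand no longer involves the parameter, and `ρ` integrates
        -- to one.
        rw [integral_fun_snd (fun x => ∑ σ, Real.exp (l * signedSup 𝒞 σ x))]
        simp

/-- The population mean is the ghost sample's expected mean, so Jensen's inequality applies. A lower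
integral on the right gives the bound for every `q`, even where the section of `symmetrized` is not
measurable. -/
theorem ofReal_exp_deviation_le (h𝒞 : ∀ c ∈ 𝒞, Measurable c ∧ ∀ x, |c x| ≤ 1) {c : 𝓧 → ℝ}
    (hc : c ∈ 𝒞) (hn : 0 < n) {h : Z × 𝓧 → ℝ} (hhm : Measurable h) (hh : ∀ p, |h p| ≤ 1) {l : ℝ}
    (hl : 0 ≤ l) (q : Z × (Fin n → 𝓧)) :
    ENNReal.ofReal (Real.exp (l * ((1 / (n : ℝ)) * ∑ i, h (q.1, q.2 i) * c (q.2 i)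
        - ∫ x, h (q.1, x) * c x ∂Q)))
      ≤ ∫⁻ x', ENNReal.ofReal (symmetrized 𝒞 (2 * l) h (q, x')) ∂(Measure.pi fun _ => Q) := by
  have hn' : (n : ℝ) ≠ 0 := by exact_mod_cast hn.ne'
  set ν := Measure.pi fun _ : Fin n => Q
  set g : 𝓧 → ℝ := fun x => h (q.1, x) * c x
  have hgm : Measurable g := by
    have := (h𝒞 c hc).1
    fun_prop
  have hgb : ∀ x, |g x| ≤ 1 := fun x => by
    rw [abs_mul]
    exact mul_le_one₀ (hh _) (abs_nonneg _) ((h𝒞 c hc).2 x)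
  set ξ : (Fin n → 𝓧) → ℝ := fun x' =>
    (1 / (n : ℝ)) * ∑ i, g (q.2 i) - (1 / (n : ℝ)) * ∑ i, g (x' i)
  have hξm : Measurable ξ := by fun_prop
  have hξb : ∀ x', |ξ x'| ≤ 1 + 1 := fun x' =>
    (abs_sub _ _).trans (add_le_add (abs_mean_le_one fun _ => hgb _)
      (abs_mean_le_one fun _ => hgb _))
  have hcoord : ∀ i : Fin n, ∫ x' : Fin n → 𝓧, g (x' i) ∂ν = ∫ x, g x ∂Q := fun i => by
    have hmp := measurePreserving_eval (fun _ : Fin n => Q) i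
    have h := integral_map hmp.measurable.aemeasurable
      (hgm.aestronglyMeasurable (μ := (Measure.pi fun _ : Fin n => Q).map (Function.eval i)))
    rw [hmp.map_eq] at h
    exact h.symm
  have hci : ∀ i : Fin n, Integrable (fun x' : Fin n → 𝓧 => g (x' i)) ν := fun i =>
    integrable_of_abs_le (hgm.comp (measurable_pi_apply i)).aemeasurable fun x' => hgb (x' i)
  have hξint : ∫ x', ξ x' ∂ν = (1 / (n : ℝ)) * ∑ i, g (q.2 i) - ∫ x, g x ∂Q := by
    simp only [ξ]
    rw [integral_sub (integrable_const _) ((integrable_finsetSum _ fun i _ => hci i).const_mul _),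
      integral_const_mul (1 / (n : ℝ)) (fun x' : Fin n → 𝓧 => ∑ i, g (x' i)),
      integral_finsetSum _ fun i _ => hci i]
    simp only [hcoord]
    simp [hn']
  have hexpi := integrable_exp_mul_of_abs_le (μ := ν) hξm.aemeasurable hξb l
  have hjensen : Real.exp (l * ∫ x', ξ x' ∂ν) ≤ ∫ x', Real.exp (l * ξ x') ∂ν := by
    rw [← integral_const_mul]
    exact convexOn_exp.map_integral_le Real.continuous_exp.continuousOn isClosed_univ
      (Filter.Eventually.of_forall fun _ => Set.mem_univ _)
      ((integrable_of_abs_le hξm.aemeasurable hξb).const_mul l) hexpi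
  rw [← hξint]
  refine (ENNReal.ofReal_le_ofReal hjensen).trans ?_
  rw [ofReal_integral_eq_lintegral_ofReal hexpi
    (Filter.Eventually.of_forall fun _ => (Real.exp_pos _).le)]
  exact lintegral_mono fun x' => ENNReal.ofReal_le_ofReal
    (exp_mean_sub_mean_le_symmetrized (fun c hc => (h𝒞 c hc).2) hc hh hl (q, x'))

/-- Uniform deviation bound for a random multiplier `h (U, ·)` that is independent of the sample:
the outer probability that the one-sided deviation reaches `u` for some `c ∈ 𝒞`. -/
theorem measure_exists_deviation_ge_le (h𝒞 : ∀ c ∈ 𝒞, Measurable c ∧ ∀ x, |c x| ≤ 1)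
    (hm : RademacherMeasurable 𝒞 n Q) (hn : 0 < n) {h : Z × 𝓧 → ℝ} (hhm : Measurable h)
    (hh : ∀ p, |h p| ≤ 1) {l : ℝ} (hl : 0 ≤ l) (u : ℝ) {Ω : Type*} [MeasurableSpace Ω]
    {μ : Measure Ω} {U : Ω → Z} {X : Ω → Fin n → 𝓧}
    (hlaw : HasLaw (fun ω => (U ω, X ω)) (ρ.prod (Measure.pi fun _ => Q)) μ) :
    μ {ω | ∃ c ∈ 𝒞, u ≤ (1 / (n : ℝ)) * ∑ i, h (U ω, X ω i) * c (X ω i)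
        - ∫ x, h (U ω, x) * c x ∂Q}
      ≤ ENNReal.ofReal (Real.exp (2 * l * rademacher 𝒞 n Q + 4 * l ^ 2 / n - l * u)) := by
  set ν := Measure.pi fun _ : Fin n => Q
  set M : Z × (Fin n → 𝓧) → ENNReal := fun q =>
    ∫⁻ x', ENNReal.ofReal (symmetrized 𝒞 (2 * l) h (q, x')) ∂ν
  have hb : ∀ c ∈ 𝒞, ∀ x, |c x| ≤ 1 := fun c hc => (h𝒞 c hc).2
  have hsi := integrable_symmetrized (ρ := ρ) hb hm hhm hh (2 * l)
  have hsm := hsi.1.aemeasurable.ennreal_ofReal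
  have hMm : AEMeasurable M (ρ.prod ν) := hsm.lintegral_prod_right'
  have hMint : ∫⁻ q, M q ∂(ρ.prod ν)
      ≤ ENNReal.ofReal (Real.exp (2 * l * rademacher 𝒞 n Q + (2 * l) ^ 2 / n)) := by
    rw [← lintegral_prod _ hsm, ← ofReal_integral_eq_lintegral_ofReal hsi
      (Filter.Eventually.of_forall (symmetrized_nonneg hh (2 * l)))]
    exact ENNReal.ofReal_le_ofReal (integral_symmetrized_le hb hm hn hhm hh (2 * l))
  have hMm' : AEMeasurable (fun ω => M (U ω, X ω)) μ := by
    rw [← hlaw.map_eq] at hMm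
    exact hMm.comp_aemeasurable hlaw.aemeasurable
  have hMint' : ∫⁻ ω, M (U ω, X ω) ∂μ = ∫⁻ q, M q ∂(ρ.prod ν) := by
    rw [← hlaw.map_eq] at hMm ⊢
    exact (lintegral_map' hMm hlaw.aemeasurable).symm
  have hpos : 0 < ENNReal.ofReal (Real.exp (l * u)) := ENNReal.ofReal_pos.2 (Real.exp_pos _)
  calc μ {ω | ∃ c ∈ 𝒞, u ≤ (1 / (n : ℝ)) * ∑ i, h (U ω, X ω i) * c (X ω i)
        - ∫ x, h (U ω, x) * c x ∂Q}
      -- The event need not be measurable; it lies in a superlevel set of the a.e. measurable `M`,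
      -- where Markov's inequality is available.
      ≤ μ {ω | ENNReal.ofReal (Real.exp (l * u)) ≤ M (U ω, X ω)} := by
        refine measure_mono ?_
        rintro ω ⟨c, hc, hu⟩
        refine le_trans (ENNReal.ofReal_le_ofReal (Real.exp_le_exp.2
          (mul_le_mul_of_nonneg_left hu hl))) ?_
        exact ofReal_exp_deviation_le h𝒞 hc hn hhm hh hl (U ω, X ω)
    _ ≤ (∫⁻ ω, M (U ω, X ω) ∂μ) / ENNReal.ofReal (Real.exp (l * u)) :=
        meas_ge_le_lintegral_div hMm' hpos.ne' ENNReal.ofReal_ne_top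
    _ ≤ ENNReal.ofReal (Real.exp (2 * l * rademacher 𝒞 n Q + (2 * l) ^ 2 / n))
          / ENNReal.ofReal (Real.exp (l * u)) := by
        rw [hMint']
        exact ENNReal.div_le_div_right hMint _
    _ = _ := by
        rw [← ENNReal.ofReal_div_of_pos (Real.exp_pos _), ← Real.exp_sub]
        ring_nf

end Deviation

/-! ### Population moments from positive and unlabeled data, and through the regression function. -/

section Moments

variable {𝓧 : Type*} [MeasurableSpace 𝓧] {P : Measure (𝓧 × Bool)}

theorem measurable_label : Measurable label := measurable_of_finite _

theorem label_mem_Icc (y : Bool) : label y ∈ Set.Icc (0 : ℝ) 1 := by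
  cases y <;> simp [label]

theorem measurableSet_positive : MeasurableSet (Prod.snd ⁻¹' {true} : Set (𝓧 × Bool)) :=
  measurable_snd (measurableSet_singleton true)

theorem isProbabilityMeasure_posDist [IsFiniteMeasure P] (hπ : 0 < prior P) :
    IsProbabilityMeasure (posDist P) := by
  have h : P (Prod.snd ⁻¹' {true}) ≠ 0 := fun h => by simp [prior, Measure.real, h] at hπ
  have := cond_isProbabilityMeasure h
  exact Measure.isProbabilityMeasure_map measurable_fst.aemeasurable

theorem isProbabilityMeasure_inputDist [IsProbabilityMeasure P] :
    IsProbabilityMeasure (inputDist P) :=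
  Measure.isProbabilityMeasure_map measurable_fst.aemeasurable

theorem prior_le_one [IsProbabilityMeasure P] : prior P ≤ 1 := measureReal_le_one

theorem integral_inputDist {g : 𝓧 → ℝ} (hg : Measurable g) :
    ∫ x, g x ∂(inputDist P) = ∫ p, g p.1 ∂P :=
  integral_map measurable_fst.aemeasurable hg.aestronglyMeasurable

theorem integral_mul_label (hπ : 0 < prior P) {g : 𝓧 → ℝ} (hg : Measurable g) :
    ∫ p, g p.1 * label p.2 ∂P = prior P * ∫ x, g x ∂(posDist P) := by
  set s : Set (𝓧 × Bool) := Prod.snd ⁻¹' {true}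
  have h1 : ∫ x, g x ∂(posDist P) = (prior P)⁻¹ * ∫ p in s, g p.1 ∂P := by
    rw [posDist, integral_map measurable_fst.aemeasurable hg.aestronglyMeasurable, ProbabilityTheory.cond,
      integral_smul_measure, smul_eq_mul, ENNReal.toReal_inv]
    rfl
  rw [h1, mul_inv_cancel_left₀ hπ.ne', ← integral_indicator measurableSet_positive]
  congr 1
  ext p
  by_cases hp : p.2 = true <;> simp [label, hp, Set.indicator]

theorem measurable_score {f : 𝓧 → unitInterval} (hf : Measurable f) :
    Measurable fun x => (f x : ℝ) := measurable_subtype_coe.comp hf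

theorem abs_coe_unitInterval_le (v : unitInterval) : |(v : ℝ)| ≤ 1 := by
  rw [abs_of_nonneg v.2.1]
  exact v.2.2

theorem abs_mul_le_one {a b : ℝ} (ha : |a| ≤ 1) (hb : |b| ≤ 1) : |a * b| ≤ 1 := by
  rw [abs_mul]
  exact mul_le_one₀ ha (abs_nonneg b) hb

/-- The witness moment is identified from positive and unlabeled data. -/
theorem moment_eq [IsProbabilityMeasure P] (hπ : 0 < prior P) {c : 𝓧 → ℝ}
    {w : unitInterval → ℝ} {f : 𝓧 → unitInterval} (hcm : Measurable c) (hc : ∀ x, |c x| ≤ 1)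
    (hwm : Measurable w) (hw : ∀ v, |w v| ≤ 1) (hf : Measurable f) :
    moment P c w f = prior P * ∫ x, w (f x) * c x ∂(posDist P)
      - ∫ x, w (f x) * (f x : ℝ) * c x ∂(inputDist P) := by
  have hf' := measurable_score hf
  have hg1 : Measurable fun x => w (f x) * c x := (hwm.comp hf).mul hcm
  have hg2 : Measurable fun x => w (f x) * (f x : ℝ) * c x := ((hwm.comp hf).mul hf').mul hcm
  have hlab : Measurable fun p : 𝓧 × Bool => label p.2 := measurable_label.comp measurable_snd
  rw [← integral_mul_label hπ hg1, integral_inputDist hg2, ← integral_sub, moment]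
  · congr 1
    ext p
    ring
  · refine integrable_of_abs_le (B := 1) ((hg1.comp measurable_fst).mul hlab).aemeasurable
      fun p => abs_mul_le_one (abs_mul_le_one (hw _) (hc _)) ?_
    rw [abs_of_nonneg (label_mem_Icc _).1]
    exact (label_mem_Icc _).2
  · exact integrable_of_abs_le (B := 1) (hg2.comp measurable_fst).aemeasurable
      fun p => abs_mul_le_one (abs_mul_le_one (hw _) (abs_coe_unitInterval_le _)) (hc _)

theorem measurable_regression [IsFiniteMeasure P] : Measurable (regression P) := by
  have : StronglyMeasurable fun x => ∫ y, label y ∂(P.condKernel x) :=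
    (measurable_label.stronglyMeasurable.comp_measurable measurable_snd).integral_kernel_prod_right'
      (κ := P.condKernel) (f := fun p : 𝓧 × Bool => label p.2)
  exact this.measurable

theorem regression_mem_Icc [IsFiniteMeasure P] (x : 𝓧) : regression P x ∈ Set.Icc (0 : ℝ) 1 := by
  have hi : Integrable label (P.condKernel x) :=
    integrable_of_abs_le (B := 1) measurable_label.aemeasurable fun y => by
      rw [abs_of_nonneg (label_mem_Icc _).1]
      exact (label_mem_Icc _).2
  refine ⟨integral_nonneg fun y => (label_mem_Icc y).1, ?_⟩
  have := integral_mono hi (integrable_const 1) fun y => (label_mem_Icc y).2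
  rwa [integral_const, probReal_univ, one_smul] at this

theorem integral_mul_label_eq_regression [IsProbabilityMeasure P] {g : 𝓧 → ℝ} {B : ℝ}
    (hg : Measurable g) (hB : ∀ x, |g x| ≤ B) :
    ∫ p, g p.1 * label p.2 ∂P = ∫ p, g p.1 * regression P p.1 ∂P := by
  have hi : Integrable (fun p : 𝓧 × Bool => g p.1 * label p.2) P := by
    refine integrable_of_abs_le (B := B)
      ((hg.comp measurable_fst).mul (measurable_label.comp measurable_snd)).aemeasurable fun p => ?_
    rw [abs_mul, abs_of_nonneg (label_mem_Icc p.2).1]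
    exact (mul_le_of_le_one_right (abs_nonneg _) (label_mem_Icc p.2).2).trans (hB _)
  rw [← Measure.integral_condKernel hi]
  simp only [integral_const_mul]
  exact integral_map measurable_fst.aemeasurable
    (hg.mul measurable_regression).aestronglyMeasurable

/-- The form needed for the potential argument: the moment is an inner product with `f⋆ - f`. -/
theorem moment_eq_integral_regression [IsProbabilityMeasure P] {c : 𝓧 → ℝ}
    {w : unitInterval → ℝ} {f : 𝓧 → unitInterval} (hcm : Measurable c) (hc : ∀ x, |c x| ≤ 1)
    (hwm : Measurable w) (hw : ∀ v, |w v| ≤ 1) (hf : Measurable f) :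
    moment P c w f = ∫ p, c p.1 * w (f p.1) * (regression P p.1 - (f p.1 : ℝ)) ∂P := by
  have hf' := measurable_score hf
  have hr := measurable_regression (P := P)
  have hg : Measurable fun x => c x * w (f x) := hcm.mul (hwm.comp hf)
  have hgb : ∀ x, |c x * w (f x)| ≤ 1 := fun x => abs_mul_le_one (hc x) (hw _)
  have habs {r : ℝ} (h : r ∈ Set.Icc (0 : ℝ) 1) : |r| ≤ 1 := by
    rw [abs_of_nonneg h.1]
    exact h.2
  have h0 : Integrable (fun p : 𝓧 × Bool => c p.1 * w (f p.1) * (f p.1 : ℝ)) P :=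
    integrable_of_abs_le (B := 1) ((hg.mul hf').comp measurable_fst).aemeasurable
      fun p => abs_mul_le_one (hgb _) (abs_coe_unitInterval_le _)
  have h1 : Integrable (fun p : 𝓧 × Bool => c p.1 * w (f p.1) * label p.2) P :=
    integrable_of_abs_le (B := 1)
      ((hg.comp measurable_fst).mul (measurable_label.comp measurable_snd)).aemeasurable
      fun p => abs_mul_le_one (hgb _) (habs (label_mem_Icc _))
  have h2 : Integrable (fun p : 𝓧 × Bool => c p.1 * w (f p.1) * regression P p.1) P :=
    integrable_of_abs_le (B := 1) ((hg.mul hr).comp measurable_fst).aemeasurable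
      fun p => abs_mul_le_one (hgb _) (habs (regression_mem_Icc _))
  simp only [moment, mul_sub]
  rw [integral_sub h1 h0, integral_sub h2 h0, integral_mul_label_eq_regression hg hgb]

end Moments

/-! ### The potential argument for a run with accurate moments. -/

section Run

variable {𝓧 : Type*} [MeasurableSpace 𝓧] {P : Measure (𝓧 × Bool)}

theorem measurable_direction {q : Witness 𝓧} (hcm : Measurable q.group)
    (hwm : Measurable q.test) {f : 𝓧 → unitInterval} (hf : Measurable f) :
    Measurable fun x => q.direction x (f x) :=
  (hcm.const_mul _).mul (hwm.comp hf)

theorem measurable_update {q : Witness 𝓧} (hcm : Measurable q.group)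
    (hwm : Measurable q.test) {f : 𝓧 → unitInterval} (hf : Measurable f) (lam : ℝ) :
    Measurable (update lam q f) :=
  continuous_projIcc.measurable.comp
    ((measurable_score hf).add ((measurable_direction hcm hwm hf).const_mul lam))

theorem abs_projIcc_sub_le (a : ℝ) {r : ℝ} (hr : r ∈ Set.Icc (0 : ℝ) 1) :
    |(Set.projIcc (0 : ℝ) 1 zero_le_one a : ℝ) - r| ≤ |a - r| := by
  have h := Set.abs_projIcc_sub_projIcc (a := (0 : ℝ)) (b := 1) (c := a) (d := r) zero_le_one
  rwa [Set.projIcc_of_mem zero_le_one hr] at h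

/-- An update along a direction whose moment exceeds `ε / 2` lowers the squared distance to the
regression function by at least `ε² / 4`. -/
theorem initialGap_update_add_le [IsProbabilityMeasure P] {ε : ℝ} (hε : 0 < ε) {q : Witness 𝓧}
    (hcm : Measurable q.group) (hc : ∀ x, |q.group x| ≤ 1) (hwm : Measurable q.test)
    (hw : ∀ v, |q.test v| ≤ 1) {f : 𝓧 → unitInterval} (hf : Measurable f)
    (hq : ε / 2 < ((q.sign : ℤ) : ℝ) * moment P q.group q.test f) :
    initialGap P (update (ε / 2) q f) + ε ^ 2 / 4 ≤ initialGap P f := by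
  have hf' := measurable_score hf
  have hr := measurable_regression (P := P)
  set D : 𝓧 → ℝ := fun x => q.direction x (f x)
  set e : 𝓧 → ℝ := fun x => (f x : ℝ) - regression P x
  have hDm : Measurable D := measurable_direction hcm hwm hf
  have hem : Measurable e := hf'.sub hr
  have hDb : ∀ x, |D x| ≤ 1 := fun x => abs_mul_le_one (abs_sign_mul_le hc _ _) (hw _)
  have heb : ∀ x, |e x| ≤ 1 := fun x => by
    have h1 := (f x).2
    have h2 := regression_mem_Icc (P := P) x
    rw [abs_le]
    constructor <;> simp only [e] <;> linarith [h1.1, h1.2, h2.1, h2.2]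
  have hint {g : 𝓧 → ℝ} (hg : Measurable g) (hb : ∀ x, |g x| ≤ 1) :
      Integrable (fun p : 𝓧 × Bool => g p.1) P :=
    integrable_of_abs_le (hg.comp measurable_fst).aemeasurable fun p => hb p.1
  have hee : Integrable (fun p : 𝓧 × Bool => e p.1 ^ 2) P := by
    simp only [pow_two]
    exact hint (hem.mul hem) fun x => abs_mul_le_one (heb x) (heb x)
  have hDe : Integrable (fun p : 𝓧 × Bool => D p.1 * e p.1) P :=
    hint (hDm.mul hem) fun x => abs_mul_le_one (hDb x) (heb x)
  have hmoment : ((q.sign : ℤ) : ℝ) * moment P q.group q.test f = -∫ p, D p.1 * e p.1 ∂P := by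
    rw [moment_eq_integral_regression hcm hc hwm hw hf, ← integral_const_mul, ← integral_neg]
    congr 1
    ext p
    simp only [D, e, Witness.direction]
    ring
  -- Projection onto `[0, 1]` does not increase the distance to `f⋆(x) ∈ [0, 1]`; the square is then
  -- expanded using `|D x| ≤ 1`.
  have hpt : ∀ x, ((update (ε / 2) q f x : ℝ) - regression P x) ^ 2
      ≤ e x ^ 2 + ε * (D x * e x) + ε ^ 2 / 4 := fun x => by
    have h1 := sq_le_sq.2 (abs_projIcc_sub_le ((f x : ℝ) + ε / 2 * D x)
      (regression_mem_Icc (P := P) x))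
    refine h1.trans ?_
    have h2 : D x ^ 2 ≤ 1 := by
      rw [sq_le_one_iff_abs_le_one]
      exact hDb x
    have h3 : ε ^ 2 / 4 * D x ^ 2 ≤ ε ^ 2 / 4 * 1 :=
      mul_le_mul_of_nonneg_left h2 (by positivity)
    simp only [e]
    linarith
  have hupd : Integrable (fun p : 𝓧 × Bool =>
      ((update (ε / 2) q f p.1 : ℝ) - regression P p.1) ^ 2) P := by
    refine hint (g := fun x => ((update (ε / 2) q f x : ℝ) - regression P x) ^ 2)
      (((measurable_score (measurable_update hcm hwm hf _)).sub hr).pow_const 2) fun x => ?_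
    have h1 := (update (ε / 2) q f x).2
    have h2 := regression_mem_Icc (P := P) x
    rw [abs_of_nonneg (sq_nonneg _), sq_le_one_iff_abs_le_one, abs_le]
    constructor <;> linarith [h1.1, h1.2, h2.1, h2.2]
  have hsum : Integrable (fun p : 𝓧 × Bool => e p.1 ^ 2 + ε * (D p.1 * e p.1)) P :=
    hee.add (hDe.const_mul ε)
  have hmono := integral_mono hupd (hsum.add (integrable_const (ε ^ 2 / 4))) fun p => hpt p.1
  simp only [Pi.add_apply] at hmono
  rw [integral_add hsum (integrable_const _), integral_add hee (hDe.const_mul ε),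
    integral_const_mul, integral_const, probReal_univ, one_smul] at hmono
  have hgap : initialGap P f = ∫ p, e p.1 ^ 2 ∂P := rfl
  have hgap' : initialGap P (update (ε / 2) q f)
      = ∫ p, ((update (ε / 2) q f p.1 : ℝ) - regression P p.1) ^ 2 ∂P := rfl
  rw [hgap, hgap']
  -- The linear term is below `-ε · ε/2` and the quadratic term is at most `ε²/4`, a net change of
  -- at most `-ε²/4`.
  nlinarith [hmono, hq, hmoment]

variable {np nu : ℕ} {𝒞 : Set (𝓧 → ℝ)} {𝒲 : Finset (unitInterval → ℝ)} {f₀ : 𝓧 → unitInterval}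
  {rule : Rule 𝓧 np nu} {ε : ℝ} {S : ℕ → Batch 𝓧 np nu}

/-- The empirical moments are uniformly `ε / 4`-accurate for the iterate in step `t`. -/
def Accurate (P : Measure (𝓧 × Bool)) (ε : ℝ) (𝒞 : Set (𝓧 → ℝ)) (𝒲 : Finset (unitInterval → ℝ))
    (f₀ : 𝓧 → unitInterval) (rule : Rule 𝓧 np nu) (S : ℕ → Batch 𝓧 np nu) (t : ℕ) : Prop :=
  ∀ c ∈ 𝒞, ∀ w ∈ 𝒲, |empMoment (prior P) c w (iterate ε f₀ rule S t) (S t)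
    - moment P c w (iterate ε f₀ rule S t)| ≤ ε / 4

theorem sign_mul_le_abs (s : ℤˣ) (r : ℝ) : ((s : ℤ) : ℝ) * r ≤ |r| := by
  rcases Int.units_eq_one_or s with rfl | rfl
  · simpa using le_abs_self r
  · simpa using neg_le_abs r

theorem initialGap_iterate_add_le [IsProbabilityMeasure P] (hε : 0 < ε)
    (h𝒞 : ∀ c ∈ 𝒞, Measurable c ∧ ∀ x, |c x| ≤ 1) (h𝒲 : ∀ w ∈ 𝒲, Measurable w ∧ ∀ v, |w v| ≤ 1)
    (hvalid : rule.IsValid (prior P) ε 𝒞 𝒲 f₀)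
    (hmeas : ∀ t, Measurable (iterate ε f₀ rule S t)) (T : ℕ)
    (hacc : ∀ t < T, Accurate P ε 𝒞 𝒲 f₀ rule S t)
    (hcont : ∀ t < T, Continues (prior P) ε 𝒞 𝒲 f₀ rule S t) :
    initialGap P (iterate ε f₀ rule S T) + T * (ε ^ 2 / 4) ≤ initialGap P f₀ := by
  induction T with
  | zero => simp [iterate]
  | succ T ih =>
    obtain ⟨hc, hw, hviol⟩ := hvalid S T fun s hs => hcont s (by omega)
    set q := rule T fun i => S i
    have hdev := hacc T (by omega) q.group hc q.test hw
    have hsign := sign_mul_le_abs q.sign (empMoment (prior P) q.group q.test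
      (iterate ε f₀ rule S T) (S T) - moment P q.group q.test (iterate ε f₀ rule S T))
    rw [mul_sub] at hsign
    have hstep := initialGap_update_add_le (P := P) hε (h𝒞 _ hc).1 (h𝒞 _ hc).2 (h𝒲 _ hw).1
      (h𝒲 _ hw).2 (hmeas T) (by linarith)
    have hprev := ih (fun t ht => hacc t (by omega)) fun t ht => hcont t (by omega)
    have hupd : iterate ε f₀ rule S (T + 1) = update (ε / 2) q (iterate ε f₀ rule S T) := rfl
    rw [hupd]
    push_cast
    linarith

theorem isMulticalibrated_of_not_continues (hε : 0 < ε) {T : ℕ}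
    (hacc : Accurate P ε 𝒞 𝒲 f₀ rule S T)
    (hhalt : ¬ Continues (prior P) ε 𝒞 𝒲 f₀ rule S T) :
    IsMulticalibrated P 𝒞 𝒲 ε (iterate ε f₀ rule S T) := by
  -- Nonnegativity of `ε` covers an empty set of moments, whose supremum is `0` by default.
  refine Real.sSup_le ?_ hε.le
  rintro _ ⟨c, hc, w, hw, rfl⟩
  have hdev := abs_le.1 (hacc c hc w hw)
  have hle (s : ℤˣ) : ((s : ℤ) : ℝ) * empMoment (prior P) c w (iterate ε f₀ rule S T) (S T)
      ≤ 3 * ε / 4 := by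
    by_contra hlt
    exact hhalt ⟨⟨s, c, w⟩, hc, hw, not_le.1 hlt⟩
  have h1 := hle 1
  have h2 := hle (-1)
  push_cast at h1 h2
  rw [abs_le]
  constructor <;> linarith [hdev.1, hdev.2]

/-- Termination and correctness of a run whose empirical moments are accurate. -/
theorem exists_stopsAfter_of_accurate [IsProbabilityMeasure P] (hε : 0 < ε)
    (h𝒞 : ∀ c ∈ 𝒞, Measurable c ∧ ∀ x, |c x| ≤ 1) (h𝒲 : ∀ w ∈ 𝒲, Measurable w ∧ ∀ v, |w v| ≤ 1)
    (hvalid : rule.IsValid (prior P) ε 𝒞 𝒲 f₀)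
    (hmeas : ∀ t, Measurable (iterate ε f₀ rule S t))
    (hacc : ∀ t ≤ updateBound P f₀ ε, Accurate P ε 𝒞 𝒲 f₀ rule S t) :
    ∃ T : ℕ, StopsAfter (prior P) ε 𝒞 𝒲 f₀ rule S T ∧ T ≤ updateBound P f₀ ε ∧
      (T : ℝ) ≤ 4 * initialGap P f₀ / ε ^ 2 ∧ Measurable (iterate ε f₀ rule S T) ∧
      IsMulticalibrated P 𝒞 𝒲 ε (iterate ε f₀ rule S T) ∧
      totalDraws np T ≤ (updateBound P f₀ ε + 1) * np ∧
      totalDraws nu T ≤ (updateBound P f₀ ε + 1) * nu := by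
  -- Accuracy up to step `K_ε` permits `K_ε + 1` updates to be counted; that many would contradict
  -- the resulting bound, which forces a stop.
  have hbound : ∀ T ≤ updateBound P f₀ ε + 1,
      (∀ t < T, Continues (prior P) ε 𝒞 𝒲 f₀ rule S t) →
      (T : ℝ) ≤ 4 * initialGap P f₀ / ε ^ 2 := fun T hT hcont => by
    have h := initialGap_iterate_add_le hε h𝒞 h𝒲 hvalid hmeas T
      (fun t ht => hacc t (by omega)) hcont
    have hnn : 0 ≤ initialGap P (iterate ε f₀ rule S T) := integral_nonneg fun p => sq_nonneg _
    rw [le_div_iff₀ (by positivity)]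
    linarith
  have hex : ∃ t, ¬ Continues (prior P) ε 𝒞 𝒲 f₀ rule S t := by
    by_contra! hall
    have h1 := (hbound _ le_rfl fun t _ => hall t).trans (Nat.le_ceil _)
    have h2 : updateBound P f₀ ε + 1 ≤ updateBound P f₀ ε := by exact_mod_cast h1
    omega
  classical
  set T := Nat.find hex
  have hcont : ∀ t < T, Continues (prior P) ε 𝒞 𝒲 f₀ rule S t := fun t ht =>
    not_not.1 (Nat.find_min hex ht)
  have hTK : T ≤ updateBound P f₀ ε := by
    by_contra! hlt
    have h1 := (hbound _ le_rfl fun t ht => hcont t (by omega)).trans (Nat.le_ceil _)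
    have h2 : updateBound P f₀ ε + 1 ≤ updateBound P f₀ ε := by exact_mod_cast h1
    omega
  have hdraws (n : ℕ) : totalDraws n T ≤ (updateBound P f₀ ε + 1) * n := by
    simp only [totalDraws, Finset.sum_const, Finset.card_range, smul_eq_mul]
    exact Nat.mul_le_mul_right n (by omega)
  exact ⟨T, ⟨hcont, Nat.find_spec hex⟩, hTK, hbound T (by omega) hcont, hmeas T,
    isMulticalibrated_of_not_continues hε (hacc T hTK) (Nat.find_spec hex), hdraws np, hdraws nu⟩

end Run

/-! ### Iterates as functions of the past batches. -/

section History

variable {𝓧 : Type*} {np nu : ℕ}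

/-- The iterate in step `t` as a function of the `t` batches drawn before. -/
def iterateOn (ε : ℝ) (f₀ : 𝓧 → unitInterval) (rule : Rule 𝓧 np nu) :
    (t : ℕ) → (Fin t → Batch 𝓧 np nu) → 𝓧 → unitInterval
  | 0, _ => f₀
  | t + 1, p => update (ε / 2) (rule t p) (iterateOn ε f₀ rule t fun i => p i.castSucc)

theorem iterate_eq_iterateOn (ε : ℝ) (f₀ : 𝓧 → unitInterval) (rule : Rule 𝓧 np nu)
    (S : ℕ → Batch 𝓧 np nu) (t : ℕ) :
    iterate ε f₀ rule S t = iterateOn ε f₀ rule t fun i => S i := by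
  induction t with
  | zero => rfl
  | succ t ih =>
    rw [iterate, ih]
    rfl

variable [MeasurableSpace 𝓧]

/-- Measurability jointly in history and input makes the iterate admissible as a random multiplier
in the deviation bound. -/
theorem measurable_iterateOn (ε : ℝ) {f₀ : 𝓧 → unitInterval} (hf₀ : Measurable f₀)
    {rule : Rule 𝓧 np nu} (hrule : rule.IsMeasurable) (t : ℕ) :
    Measurable fun q : (Fin t → Batch 𝓧 np nu) × 𝓧 => iterateOn ε f₀ rule t q.1 q.2 := by
  induction t with
  | zero => exact hf₀.comp measurable_snd
  | succ t ih =>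
    have hf : Measurable fun q : (Fin (t + 1) → Batch 𝓧 np nu) × 𝓧 =>
        iterateOn ε f₀ rule t (fun i => q.1 i.castSucc) q.2 :=
      ih.comp (f := fun q : (Fin (t + 1) → Batch 𝓧 np nu) × 𝓧 =>
        ((fun i : Fin t => q.1 i.castSucc), q.2)) (by fun_prop)
    have hdir := (hrule t).comp (measurable_fst.prodMk (measurable_snd.prodMk hf))
    exact continuous_projIcc.measurable.comp
      ((measurable_subtype_coe.comp hf).add (hdir.const_mul (ε / 2)))

theorem measurable_iterate (ε : ℝ) {f₀ : 𝓧 → unitInterval} (hf₀ : Measurable f₀)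
    {rule : Rule 𝓧 np nu} (hrule : rule.IsMeasurable) (S : ℕ → Batch 𝓧 np nu) (t : ℕ) :
    Measurable (iterate ε f₀ rule S t) := by
  rw [iterate_eq_iterateOn]
  exact (measurable_iterateOn ε hf₀ hrule t).comp measurable_prodMk_left

/-- In an independent sequence, the present is independent of the past. -/
theorem hasLaw_past_present {B Ω : Type*} [MeasurableSpace B] [MeasurableSpace Ω] {μ : Measure Ω}
    [IsProbabilityMeasure μ] {ν : Measure B} {S : ℕ → Ω → B} (hindep : iIndepFun S μ)
    (hlaw : ∀ t, HasLaw (S t) ν μ) (t : ℕ) :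
    HasLaw (fun ω => ((fun i : Fin t => S i ω), S t ω))
      ((μ.map fun ω => fun i : Fin t => S i ω).prod ν) μ := by
  have hS : ∀ i, AEMeasurable (S i) μ := fun i => (hlaw i).aemeasurable
  have hpast : AEMeasurable (fun ω => fun i : Fin t => S i ω) μ :=
    aemeasurable_pi_lambda _ fun i => hS i
  have hφ : Measurable fun (a : Finset.range t → B) (i : Fin t) =>
      a ⟨i, Finset.mem_range.2 i.2⟩ := by fun_prop
  have hψ : Measurable fun a : ({t} : Finset ℕ) → B => a ⟨t, Finset.mem_singleton_self t⟩ := by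
    fun_prop
  have h := (hindep.indepFun_finset₀ (Finset.range t) {t} (by simp) hS).comp hφ hψ
  refine ⟨hpast.prodMk (hS t), ?_⟩
  rw [← (hlaw t).map_eq]
  exact (indepFun_iff_map_prod_eq_prod_map_map hpast (hS t)).1 h

end History

/-! ### Choice of constants and the union bound. -/

section Probability

/-- With `l = nε/(128κ)` and threshold `ε/(8κ)`, the part `1024 C²` of the constant yields `R ≤
ε/(32κ)`. The exponent is then at most `(lε/κ)(1/16 + 1/32 - 1/8) = -nε²/(4096κ²)`, and the part
`4096` makes this at most `-L`. -/
theorem deviation_exponent_le {C κ ε d R L : ℝ} {n : ℕ} (hn : 0 < n) (hκ : 0 < κ)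
    (hε : 0 < ε) (hd : 0 ≤ d) (hL : 0 ≤ L) (hR : R ≤ C * √(d * Real.log n / n))
    (hsize : (4096 + 1024 * C ^ 2) * κ ^ 2 / ε ^ 2 * (d * Real.log n + L) ≤ n) :
    2 * (n * ε / (128 * κ)) * R + 4 * (n * ε / (128 * κ)) ^ 2 / n
      - n * ε / (128 * κ) * (ε / (8 * κ)) ≤ -L := by
  have hn' : (0 : ℝ) < n := by exact_mod_cast hn
  have hdl : 0 ≤ d * Real.log n := mul_nonneg hd (Real.log_natCast_nonneg n)
  set q := κ ^ 2 / ε ^ 2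
  have hq : 0 < q := by positivity
  have hsize' : (4096 + 1024 * C ^ 2) * (q * (d * Real.log n + L)) ≤ n := by
    refine le_trans (le_of_eq ?_) hsize
    simp only [q]
    ring
  have hqL : 0 ≤ q * L := mul_nonneg hq.le hL
  have hqd : 0 ≤ q * (d * Real.log n) := mul_nonneg hq.le hdl
  have h1 : 1024 * C ^ 2 * (q * (d * Real.log n)) ≤ n := by
    nlinarith [mul_nonneg (sq_nonneg C) hqL]
  have h2 : 4096 * (q * L) ≤ n := by
    nlinarith [mul_nonneg (sq_nonneg C) hqL, mul_nonneg (sq_nonneg C) hqd]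
  have hR' : R ≤ ε / (32 * κ) := by
    refine hR.trans (abs_le_of_sq_le_sq' ?_ (by positivity)).2
    rw [mul_pow, Real.sq_sqrt (by positivity), div_pow, mul_div_assoc', div_le_div_iff₀ hn'
      (by positivity)]
    have h3 : 1024 * C ^ 2 * (κ ^ 2 * (d * Real.log n)) ≤ n * ε ^ 2 := by
      have := mul_le_mul_of_nonneg_right h1 (sq_nonneg ε)
      refine le_trans (le_of_eq ?_) this
      simp only [q]
      field_simp
    linarith
  have h4 : 4096 * L ≤ n * ε ^ 2 / κ ^ 2 := by
    have h5 : L = q * L * (ε ^ 2 / κ ^ 2) := by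
      simp only [q]
      field_simp
    have h6 := mul_le_mul_of_nonneg_right h2 (by positivity : 0 ≤ ε ^ 2 / κ ^ 2)
    rw [mul_assoc, ← h5] at h6
    rwa [mul_div_assoc]
  have h7 : 2 * (n * ε / (128 * κ)) * R ≤ 2 * (n * ε / (128 * κ)) * (ε / (32 * κ)) :=
    mul_le_mul_of_nonneg_left hR' (by positivity)
  have h8 : 2 * (n * ε / (128 * κ)) * (ε / (32 * κ)) + 4 * (n * ε / (128 * κ)) ^ 2 / n
      - n * ε / (128 * κ) * (ε / (8 * κ)) = -(n * ε ^ 2 / κ ^ 2) / 4096 := by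
    field_simp
    norm_num
  linarith

variable {𝓧 : Type*} [MeasurableSpace 𝓧] {𝒞 : Set (𝓧 → ℝ)}

theorem measure_exists_abs_deviation_ge_le {Z Ω : Type*} [MeasurableSpace Z] [MeasurableSpace Ω]
    {Q : Measure 𝓧} [IsProbabilityMeasure Q] {ρ : Measure Z} [IsProbabilityMeasure ρ]
    {μ : Measure Ω} {n : ℕ} {C κ ε d L : ℝ} (h𝒞 : ∀ c ∈ 𝒞, Measurable c ∧ ∀ x, |c x| ≤ 1)
    (hm : RademacherMeasurable 𝒞 n Q) (hn : 0 < n) (hκ : 0 < κ)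
    (hε : 0 < ε) (hd : 0 ≤ d) (hL : 0 ≤ L) (hR : rademacher 𝒞 n Q ≤ C * √(d * Real.log n / n))
    (hsize : (4096 + 1024 * C ^ 2) * κ ^ 2 / ε ^ 2 * (d * Real.log n + L) ≤ n)
    {h : Z × 𝓧 → ℝ} (hhm : Measurable h) (hh : ∀ p, |h p| ≤ 1) {U : Ω → Z}
    {X : Ω → Fin n → 𝓧} (hlaw : HasLaw (fun ω => (U ω, X ω)) (ρ.prod (Measure.pi fun _ => Q)) μ) :
    μ {ω | ∃ c ∈ 𝒞, ε / (8 * κ) ≤ |(1 / (n : ℝ)) * ∑ i, h (U ω, X ω i) * c (X ω i)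
        - ∫ x, h (U ω, x) * c x ∂Q|} ≤ 2 * ENNReal.ofReal (Real.exp (-L)) := by
  have hl : 0 ≤ n * ε / (128 * κ) := by positivity
  have hexp := ENNReal.ofReal_le_ofReal (Real.exp_le_exp.2
    (deviation_exponent_le hn hκ hε hd hL hR hsize))
  have h1 := (measure_exists_deviation_ge_le h𝒞 hm hn hhm hh hl (ε / (8 * κ)) hlaw).trans hexp
  -- The lower tail is the upper tail for the multiplier `-h`; `𝒞` need not be symmetric.
  have h2 := (measure_exists_deviation_ge_le (h := fun p => -h p) h𝒞 hm hn hhm.neg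
    (fun p => by rw [abs_neg]; exact hh p) hl (ε / (8 * κ)) hlaw).trans hexp
  rw [two_mul]
  refine (measure_mono ?_).trans ((measure_union_le _ _).trans (add_le_add h1 h2))
  rintro ω ⟨c, hc, hdev⟩
  rcases le_abs.1 hdev with hdev | hdev
  · exact Or.inl ⟨c, hc, hdev⟩
  · refine Or.inr ⟨c, hc, hdev.trans (le_of_eq ?_)⟩
    simp only [neg_mul, Finset.sum_neg_distrib, integral_neg]
    ring

variable {P : Measure (𝓧 × Bool)} {𝒲 : Finset (unitInterval → ℝ)}
  {f₀ : 𝓧 → unitInterval} {np nu : ℕ} {rule : Rule 𝓧 np nu} {Ω : Type*} [MeasurableSpace Ω]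
  {μ : Measure Ω} [IsProbabilityMeasure μ] {S : ℕ → Ω → Batch 𝓧 np nu} {C ε d L : ℝ}

theorem measure_not_accurate_le [IsProbabilityMeasure P] (hπ : 0 < prior P) (h𝒞 : ∀ c ∈ 𝒞, Measurable c ∧ ∀ x, |c x| ≤ 1)
    (h𝒲 : ∀ w ∈ 𝒲, Measurable w ∧ ∀ v, |w v| ≤ 1) (hf₀ : Measurable f₀)
    (hε : 0 < ε) (hd : 0 ≤ d) (hL : 0 ≤ L) (hnp : 0 < np) (hnu : 0 < nu)
    (hmp : RademacherMeasurable 𝒞 np (posDist P)) (hmu : RademacherMeasurable 𝒞 nu (inputDist P))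
    (hRp : rademacher 𝒞 np (posDist P) ≤ C * √(d * Real.log np / np))
    (hRu : rademacher 𝒞 nu (inputDist P) ≤ C * √(d * Real.log nu / nu))
    (hrule : rule.IsMeasurable) (hindep : iIndepFun S μ)
    (hlaw : ∀ t, HasLaw (S t) (batchLaw P np nu) μ)
    (hsizep : (4096 + 1024 * C ^ 2) * prior P ^ 2 / ε ^ 2 * (d * Real.log np + L) ≤ np)
    (hsizeu : (4096 + 1024 * C ^ 2) / ε ^ 2 * (d * Real.log nu + L) ≤ nu) (t : ℕ) :
    μ {ω | ¬ Accurate P ε 𝒞 𝒲 f₀ rule (fun s => S s ω) t}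
      ≤ 𝒲.card * (4 * ENNReal.ofReal (Real.exp (-L))) := by
  have := isProbabilityMeasure_posDist hπ
  have := isProbabilityMeasure_inputDist (P := P)
  set past : Ω → Fin t → Batch 𝓧 np nu := fun ω i => S i ω
  have hpast : AEMeasurable past μ := aemeasurable_pi_lambda _ fun i => (hlaw i).aemeasurable
  set ρ := μ.map past
  have : IsProbabilityMeasure ρ := Measure.isProbabilityMeasure_map hpast
  have hjoint : HasLaw (fun ω => (past ω, S t ω)) (ρ.prod (batchLaw P np nu)) μ :=
    hasLaw_past_present hindep hlaw t
  have hlawp : HasLaw (fun ω => (past ω, (S t ω).1))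
      (ρ.prod (Measure.pi fun _ : Fin np => posDist P)) μ :=
    ((MeasurePreserving.id ρ).prod measurePreserving_fst).hasLaw.comp hjoint
  have hlawu : HasLaw (fun ω => (past ω, (S t ω).2))
      (ρ.prod (Measure.pi fun _ : Fin nu => inputDist P)) μ :=
    ((MeasurePreserving.id ρ).prod measurePreserving_snd).hasLaw.comp hjoint
  set F : (Fin t → Batch 𝓧 np nu) × 𝓧 → unitInterval := fun q => iterateOn ε f₀ rule t q.1 q.2
  have hF : Measurable F := measurable_iterateOn ε hf₀ hrule t
  -- The positive mean enters with weight `π₊`, so the tolerance `ε/(8π₊)` suffices (`κ = π₊`),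
  -- whence the factor `π₊²` in its sample size. The unlabeled mean has `κ = 1`; together the errors
  -- are at most `ε/4`.
  set badp : (unitInterval → ℝ) → Set Ω := fun w => {ω | ∃ c ∈ 𝒞, ε / (8 * prior P) ≤
    |(1 / (np : ℝ)) * ∑ i, w (F (past ω, (S t ω).1 i)) * c ((S t ω).1 i)
      - ∫ x, w (F (past ω, x)) * c x ∂(posDist P)|}
  set badu : (unitInterval → ℝ) → Set Ω := fun w => {ω | ∃ c ∈ 𝒞, ε / (8 * 1) ≤
    |(1 / (nu : ℝ)) * ∑ i, w (F (past ω, (S t ω).2 i)) * (F (past ω, (S t ω).2 i) : ℝ)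
        * c ((S t ω).2 i)
      - ∫ x, w (F (past ω, x)) * (F (past ω, x) : ℝ) * c x ∂(inputDist P)|}
  have hbadp : ∀ w ∈ 𝒲, μ (badp w) ≤ 2 * ENNReal.ofReal (Real.exp (-L)) := fun w hw =>
    measure_exists_abs_deviation_ge_le (h := fun q => w (F q)) h𝒞 hmp hnp hπ hε hd hL hRp
      hsizep ((h𝒲 w hw).1.comp hF) (fun _ => (h𝒲 w hw).2 _) hlawp
  have hbadu : ∀ w ∈ 𝒲, μ (badu w) ≤ 2 * ENNReal.ofReal (Real.exp (-L)) := fun w hw =>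
    measure_exists_abs_deviation_ge_le (h := fun q => w (F q) * (F q : ℝ)) h𝒞 hmu hnu one_pos hε
      hd hL hRu (by rwa [one_pow, mul_one])
      (((h𝒲 w hw).1.comp hF).mul (measurable_subtype_coe.comp hF))
      (fun _ => abs_mul_le_one ((h𝒲 w hw).2 _) (abs_coe_unitInterval_le _)) hlawu
  have hsub : {ω | ¬ Accurate P ε 𝒞 𝒲 f₀ rule (fun s => S s ω) t}
      ⊆ ⋃ w ∈ 𝒲, (badp w ∪ badu w) := by
    intro ω hω
    by_contra hgood
    refine hω fun c hc w hw => ?_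
    simp only [Set.mem_iUnion, Set.mem_union, not_exists, not_or] at hgood
    obtain ⟨hgp, hgu⟩ := hgood w hw
    have hp : |(1 / (np : ℝ)) * ∑ i, w (F (past ω, (S t ω).1 i)) * c ((S t ω).1 i)
      - ∫ x, w (F (past ω, x)) * c x ∂(posDist P)| < ε / (8 * prior P) :=
      not_le.1 fun hle => hgp ⟨c, hc, hle⟩
    have hu : |(1 / (nu : ℝ)) * ∑ i, w (F (past ω, (S t ω).2 i)) * (F (past ω, (S t ω).2 i) : ℝ)
        * c ((S t ω).2 i)
      - ∫ x, w (F (past ω, x)) * (F (past ω, x) : ℝ) * c x ∂(inputDist P)| < ε / (8 * 1) :=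
      not_le.1 fun hle => hgu ⟨c, hc, hle⟩
    have hiter : iterate ε f₀ rule (fun s => S s ω) t = fun x => F (past ω, x) :=
      iterate_eq_iterateOn ε f₀ rule (fun s => S s ω) t
    have hfm : Measurable fun x => F (past ω, x) := hF.comp measurable_prodMk_left
    rw [hiter, moment_eq hπ (h𝒞 c hc).1 (h𝒞 c hc).2 (h𝒲 w hw).1 (h𝒲 w hw).2 hfm]
    have hemp : empMoment (prior P) c w (fun x => F (past ω, x)) (S t ω)
        = prior P * ((1 / (np : ℝ)) * ∑ i, w (F (past ω, (S t ω).1 i)) * c ((S t ω).1 i))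
          - (1 / (nu : ℝ)) * ∑ i, w (F (past ω, (S t ω).2 i)) * (F (past ω, (S t ω).2 i) : ℝ)
              * c ((S t ω).2 i) := by
      rw [empMoment, ← mul_assoc, mul_one_div]
      congr 2
      · exact Finset.sum_congr rfl fun i _ => mul_comm _ _
      · exact Finset.sum_congr rfl fun i _ => by ring
    rw [hemp]
    have hp' := mul_le_mul_of_nonneg_left hp.le hπ.le
    rw [← abs_of_pos hπ, ← abs_mul, abs_of_pos hπ, mul_sub,
      show prior P * (ε / (8 * prior P)) = ε / 8 by field_simp] at hp'
    rw [abs_le] at hp' ⊢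
    have hu' := abs_lt.1 hu
    constructor <;> linarith [hp'.1, hp'.2, hu'.1, hu'.2]
  calc μ {ω | ¬ Accurate P ε 𝒞 𝒲 f₀ rule (fun s => S s ω) t}
      ≤ μ (⋃ w ∈ 𝒲, (badp w ∪ badu w)) := measure_mono hsub
    _ ≤ ∑ w ∈ 𝒲, μ (badp w ∪ badu w) := measure_biUnion_finset_le _ _
    _ ≤ ∑ _w ∈ 𝒲, 4 * ENNReal.ofReal (Real.exp (-L)) := by
        refine Finset.sum_le_sum fun w hw => (measure_union_le _ _).trans
          ((add_le_add (hbadp w hw) (hbadu w hw)).trans (le_of_eq ?_))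
        rw [← add_mul]
        norm_num
    _ = 𝒲.card * (4 * ENNReal.ofReal (Real.exp (-L))) := by
        rw [Finset.sum_const, nsmul_eq_mul]

theorem exists_event_accurate {δ : ℝ} {K : ℕ}
    (hstep : ∀ t, μ {ω | ¬ Accurate P ε 𝒞 𝒲 f₀ rule (fun s => S s ω) t}
      ≤ 𝒲.card * (4 * ENNReal.ofReal (Real.exp (-L))))
    (hδ : (K + 1) * (𝒲.card * (4 * Real.exp (-L))) ≤ δ) :
    ∃ G : Set Ω, MeasurableSet G ∧ 1 - δ ≤ μ.real G ∧
      ∀ ω ∈ G, ∀ t ≤ K, Accurate P ε 𝒞 𝒲 f₀ rule (fun s => S s ω) t := by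
  set bad : Set Ω := ⋃ t ∈ Finset.range (K + 1),
    {ω | ¬ Accurate P ε 𝒞 𝒲 f₀ rule (fun s => S s ω) t}
  have hbad : μ bad ≤ ENNReal.ofReal δ := by
    calc μ bad ≤ ∑ t ∈ Finset.range (K + 1),
          μ {ω | ¬ Accurate P ε 𝒞 𝒲 f₀ rule (fun s => S s ω) t} := measure_biUnion_finset_le _ _
      _ ≤ ∑ _t ∈ Finset.range (K + 1), 𝒲.card * (4 * ENNReal.ofReal (Real.exp (-L))) :=
          Finset.sum_le_sum fun t _ => hstep t
      _ = ENNReal.ofReal ((K + 1) * (𝒲.card * (4 * Real.exp (-L)))) := by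
          rw [Finset.sum_const, nsmul_eq_mul, Finset.card_range,
            ENNReal.ofReal_mul (by positivity), ENNReal.ofReal_mul (by positivity),
            ENNReal.ofReal_mul (by positivity), ENNReal.ofReal_natCast]
          congr 1
          · rw [← Nat.cast_add_one, ENNReal.ofReal_natCast]
          · norm_num
      _ ≤ ENNReal.ofReal δ := ENNReal.ofReal_le_ofReal hδ
  have hδ0 : 0 ≤ δ := le_trans (by positivity) hδ
  -- The bad event need not be measurable; a measurable hull has the same measure.
  refine ⟨(toMeasurable μ bad)ᶜ, (measurableSet_toMeasurable μ bad).compl, ?_, ?_⟩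
  · rw [probReal_compl_eq_one_sub (measurableSet_toMeasurable μ bad), measureReal_def,
      measure_toMeasurable]
    have := ENNReal.toReal_mono ENNReal.ofReal_ne_top hbad
    rw [ENNReal.toReal_ofReal hδ0] at this
    linarith
  · intro ω hω t ht
    by_contra hna
    refine hω (subset_toMeasurable μ bad ?_)
    simp only [bad, Set.mem_iUnion]
    exact ⟨t, Finset.mem_range.2 (by omega), hna⟩

end Probability

/-! ### Sample size arithmetic. -/

/-- Both sample size conditions of the theorem imply those of the uniform deviation bound. -/
theorem sample_size_bounds {B π ε d δ W K : ℝ} {np nu : ℕ} (hB : 0 ≤ B) (hπ0 : 0 ≤ π) (hπ1 : π ≤ 1)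
    (hd : 0 ≤ d) (hδ : 0 < δ) (hW : 0 < W) (hK : 0 < K)
    (hL : 0 ≤ Real.log (4 * W * K / δ))
    (h : ((np : ℝ) ≥ 3 * B * π ^ 2 / ε ^ 2 * (d * Real.log np + Real.log (4 * W * K / δ)) ∧
        (nu : ℝ) ≥ 3 * B / ε ^ 2 * (d * Real.log nu + Real.log (4 * W * K / δ))) ∨
      (np = nu ∧ 2 * δ ≤ W * K ∧
        (np : ℝ) ≥ 3 * B / ε ^ 2 * (d * Real.log np + Real.log W + Real.log (K / δ)))) :
    B * π ^ 2 / ε ^ 2 * (d * Real.log np + Real.log (4 * W * K / δ)) ≤ np ∧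
      B / ε ^ 2 * (d * Real.log nu + Real.log (4 * W * K / δ)) ≤ nu := by
  set L := Real.log (4 * W * K / δ)
  have hdl (n : ℕ) : 0 ≤ d * Real.log n := mul_nonneg hd (Real.log_natCast_nonneg n)
  have hscale {r x y : ℝ} (hr : 0 ≤ r) (hxy : x ≤ 3 * y) : r * x ≤ 3 * (r * y) := by
    nlinarith [mul_le_mul_of_nonneg_left hxy hr]
  rcases h with ⟨hp, hu⟩ | ⟨rfl, hWK, hn⟩
  · constructor
    · refine (hscale (by positivity) (?_ : _ ≤ 3 * (d * Real.log np + L))).trans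
        (le_trans (le_of_eq ?_) hp)
      · linarith [hdl np]
      · ring
    · refine (hscale (by positivity) (?_ : _ ≤ 3 * (d * Real.log nu + L))).trans
        (le_trans (le_of_eq ?_) hu)
      · linarith [hdl nu]
      · ring
  · have hM : 2 ≤ W * K / δ := by rwa [le_div_iff₀ hδ]
    have hlogM : Real.log (W * K / δ) = Real.log W + Real.log (K / δ) := by
      rw [mul_div_assoc, Real.log_mul hW.ne' (by positivity)]
    -- With `M = WK/δ ≥ 2`, `log (4M) = 2 log 2 + log M ≤ 3 log M`; hence the factor `3` in the
    -- constant.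
    have hL3 : L ≤ 3 * Real.log (W * K / δ) := by
      have h4 : L = Real.log (2 ^ 2 * (W * K / δ)) := by
        simp only [L]
        congr 1
        ring
      rw [h4, Real.log_mul (by norm_num) (by positivity), Real.log_pow]
      have := Real.log_le_log (by norm_num) hM
      push_cast
      linarith
    have hu : B / ε ^ 2 * (d * Real.log np + L) ≤ np := by
      refine (hscale (by positivity)
        (?_ : _ ≤ 3 * (d * Real.log np + Real.log (W * K / δ)))).trans (le_trans (le_of_eq ?_) hn)
      · linarith [hdl np]
      · rw [hlogM]
        ring
    refine ⟨le_trans ?_ hu, hu⟩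
    refine mul_le_mul_of_nonneg_right ?_ (add_nonneg (hdl np) hL)
    refine div_le_div_of_nonneg_right ?_ (by positivity)
    exact mul_le_of_le_one_right hB (pow_le_one₀ hπ0 hπ1)

theorem pos_of_sample_size {B ε d L : ℝ} {n : ℕ} (hB : 0 < B) (hε : 0 < ε) (hd : 0 ≤ d)
    (hL : 0 < L) (h : B / ε ^ 2 * (d * Real.log n + L) ≤ n) : 0 < n := by
  have hdl : 0 ≤ d * Real.log n := mul_nonneg hd (Real.log_natCast_nonneg n)
  have : (0 : ℝ) < n := lt_of_lt_of_le (by positivity) h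
  exact_mod_cast this

end WLMC

end

/-! ### Assembly of the theorem. -/

theorem mainTheorem4 (C_R : ℝ) (hC_R : 0 ≤ C_R) :
    ∃ A : ℝ, 0 < A ∧
      ∀ (𝓧 : Type u) [MeasurableSpace 𝓧]
        (P : Measure (𝓧 × Bool)) [IsProbabilityMeasure P] (_hπ : 0 < WLMC.prior P)
        (𝒞 : Set (𝓧 → ℝ)) (_h𝒞 : ∀ c ∈ 𝒞, Measurable c ∧ ∀ x, |c x| ≤ 1)
        (𝒲 : Finset (unitInterval → ℝ)) (_h𝒲 : ∀ w ∈ 𝒲, Measurable w ∧ ∀ v, |w v| ≤ 1)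
        (f₀ : 𝓧 → unitInterval) (_hf₀ : Measurable f₀)
        (ε δ d : ℝ) (_hε : 0 < ε) (_hδ : 0 < δ) (_hd : 0 ≤ d)
        (np nu : ℕ)
        (_hmp : WLMC.RademacherMeasurable 𝒞 np (WLMC.posDist P))
        (_hmu : WLMC.RademacherMeasurable 𝒞 nu (WLMC.inputDist P))
        (_hRp : WLMC.rademacher 𝒞 np (WLMC.posDist P) ≤ C_R * √(d * Real.log np / np))
        (_hRu : WLMC.rademacher 𝒞 nu (WLMC.inputDist P) ≤ C_R * √(d * Real.log nu / nu))
        (rule : WLMC.Rule 𝓧 np nu) (_hvalid : rule.IsValid (WLMC.prior P) ε 𝒞 𝒲 f₀)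
        (_hmeas : rule.IsMeasurable)
        (Ω : Type v) [MeasurableSpace Ω] (μ : Measure Ω) [IsProbabilityMeasure μ]
        (S : ℕ → Ω → WLMC.Batch 𝓧 np nu)
        (_hindep : iIndepFun S μ)
        (_hlaw : ∀ t, HasLaw (S t) (WLMC.batchLaw P np nu) μ),
        ( -- general batch sizes
          ((np : ℝ) ≥ A * WLMC.prior P ^ 2 / ε ^ 2 *
              (d * Real.log np +
                Real.log (4 * (𝒲.card : ℝ) * ((WLMC.updateBound P f₀ ε : ℝ) + 1) / δ)) ∧
            (nu : ℝ) ≥ A / ε ^ 2 *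
              (d * Real.log nu +
                Real.log (4 * (𝒲.card : ℝ) * ((WLMC.updateBound P f₀ ε : ℝ) + 1) / δ)))
          ∨
          -- equal batch sizes
          (np = nu ∧ 2 * δ ≤ (𝒲.card : ℝ) * ((WLMC.updateBound P f₀ ε : ℝ) + 1) ∧
            (np : ℝ) ≥ A / ε ^ 2 *
              (d * Real.log np + Real.log (𝒲.card : ℝ) +
                Real.log (((WLMC.updateBound P f₀ ε : ℝ) + 1) / δ)))) →
        ∃ G : Set Ω, MeasurableSet G ∧ 1 - δ ≤ μ.real G ∧
          ∀ ω ∈ G, ∃ T : ℕ,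
            WLMC.StopsAfter (WLMC.prior P) ε 𝒞 𝒲 f₀ rule (fun t => S t ω) T ∧
            T ≤ WLMC.updateBound P f₀ ε ∧
            (T : ℝ) ≤ 4 * WLMC.initialGap P f₀ / ε ^ 2 ∧
            Measurable (WLMC.iterate ε f₀ rule (fun t => S t ω) T) ∧
            WLMC.IsMulticalibrated P 𝒞 𝒲 ε
              (WLMC.iterate ε f₀ rule (fun t => S t ω) T) ∧
            WLMC.totalDraws np T ≤ (WLMC.updateBound P f₀ ε + 1) * np ∧
            WLMC.totalDraws nu T ≤ (WLMC.updateBound P f₀ ε + 1) * nu := by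
  set B : ℝ := 4096 + 1024 * C_R ^ 2
  have hB : 0 < B := by positivity
  refine ⟨3 * B, by positivity, ?_⟩
  intro 𝓧 _ P _ hπ 𝒞 h𝒞 𝒲 h𝒲 f₀ hf₀ ε δ d hε hδ hd np nu hmp hmu hRp hRu rule hvalid hmeas
    Ω _ μ _ S hindep hlaw hsize
  suffices hG : ∃ G : Set Ω, MeasurableSet G ∧ 1 - δ ≤ μ.real G ∧
      ∀ ω ∈ G, ∀ t ≤ WLMC.updateBound P f₀ ε,
        WLMC.Accurate P ε 𝒞 𝒲 f₀ rule (fun s => S s ω) t by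
    obtain ⟨G, hGm, hGδ, hacc⟩ := hG
    exact ⟨G, hGm, hGδ, fun ω hω => WLMC.exists_stopsAfter_of_accurate hε h𝒞 h𝒲 hvalid
      (WLMC.measurable_iterate ε hf₀ hmeas _) (hacc ω hω)⟩
  -- For empty `𝒲`, accuracy is vacuous; for `δ ≥ 1` the empty event suffices. Otherwise the
  -- argument of the logarithm exceeds `1`, so `L > 0`, which also forces both batch sizes to be
  -- positive.
  rcases 𝒲.eq_empty_or_nonempty with rfl | hne
  · exact ⟨Set.univ, MeasurableSet.univ, by simp [hδ.le], fun ω _ t _ c _ w hw => by simp at hw⟩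
  rcases le_or_gt 1 δ with hδ1 | hδ1
  · exact ⟨∅, MeasurableSet.empty, by simpa using hδ1, fun ω hω => hω.elim⟩
  have hW : (1 : ℝ) ≤ 𝒲.card := by exact_mod_cast hne.card_pos
  have hK : (1 : ℝ) ≤ (WLMC.updateBound P f₀ ε : ℝ) + 1 := by
    linarith [(WLMC.updateBound P f₀ ε).cast_nonneg (α := ℝ)]
  set K : ℝ := (WLMC.updateBound P f₀ ε : ℝ) + 1
  have hlt : 1 < 4 * (𝒲.card : ℝ) * K / δ := by
    rw [lt_div_iff₀ hδ]
    nlinarith [mul_le_mul hW hK zero_le_one (zero_le_one.trans hW)]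
  have hL := Real.log_pos hlt
  obtain ⟨hsp, hsu⟩ := WLMC.sample_size_bounds hB.le hπ.le WLMC.prior_le_one hd hδ
    (zero_lt_one.trans_le hW) (zero_lt_one.trans_le hK) hL.le hsize
  have hnp := WLMC.pos_of_sample_size (mul_pos hB (pow_pos hπ 2)) hε hd hL hsp
  have hnu := WLMC.pos_of_sample_size hB hε hd hL hsu
  refine WLMC.exists_event_accurate (WLMC.measure_not_accurate_le hπ h𝒞 h𝒲 hf₀ hε hd hL.le
    hnp hnu hmp hmu hRp hRu hmeas hindep hlaw hsp hsu) (le_of_eq ?_)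
  -- By the choice of `L`, the union bound `K · |𝒲| · 4 exp (-L)` equals `δ` exactly; here `K`
  -- denotes `K_ε + 1`.
  rw [Real.exp_neg, Real.exp_log (zero_lt_one.trans hlt)]
  change K * _ = δ
  field_simp
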